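/- Let $\mathbb k$ be an algebraically closed field of characteristic $0$, let $\mathbb k\subset K\subset L$ be fields with $L/K$ a finite Galois extension with group $G=G(L/K)$, let $\imath:K\hookrightarrow L$ be the inclusion, and let $\operatorname{Aut}L$ be the group of $\mathbb k$-automorphisms of $L$, so that $G\subset\operatorname{Aut}L$. All $K$-bimodules are $\mathbb k$-central and finite dimensional from both sides. For $\varphi\in\operatorname{Aut}L$ let $L_\varphi$ be the $L$-bimodule $L$ with $a\cdot x\cdot b=a\,x\,\varphi(b)$. A $K$-bimodule $V$ is called $L$-balanced if the $L$-bimodule $L\otimes_K V\otimes_K L$ is isomorphic to a direct sum of bimodules $L_\varphi$, $\varphi\in\operatorname{Aut}L$. Let $K_0(K,L)$ be the Grothendieck ring of the category of $L$-balanced $K$-bimodules: its additive group is generated by the classes $[V]$ with relations $[V]=[U]+[W]$ for all short exact sequences $0\to U\to V\to W\to 0$, its product is $[V][W]=[V\otimes_K W]$ and its identity is $[K]$. For $\varphi\in\operatorname{Aut}L$ put $H=\{g\in G\mid g\varphi\imath=\varphi\imath\}$, and let $V(\varphi)=(L_\varphi)^{H}$ be the $L$-balanced $K$-bimodule with underlying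 space $L^{H}$ and $a\cdot x\cdot b=a\,x\,\varphi(b)$ for $a,b\in K$. Put $b_\varphi=\sum_{\psi\in G\varphi G}\psi\in\mathbb Q[\operatorname{Aut}L]$ and $e_G=\frac1{|G|}\sum_{g\in G}g$, and let $\mathcal H_{\mathbb Q}(\operatorname{Aut}L;G)=e_G\,\mathbb Q[\operatorname{Aut}L]\,e_G$ be the Hecke algebra, with identity $e_G$. Then there is exactly one isomorphism of $\mathbb Q$-algebras $$\Psi:\mathbb Q\otimes_{\mathbb Z}K_0(K,L)\longrightarrow\mathcal H_{\mathbb Q}(\operatorname{Aut}L;G)$$ such that $\Psi(1\otimes[V(\varphi)])=\frac1{|G|}b_\varphi$ for all $\varphi\in\operatorname{Aut}L$. -/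

import Mathlib

open scoped TensorProduct

universe u v

noncomputable section

/-- A `k`-central `A`-`B`-bimodule, for commutative `k`-algebras `A` and `B`: a `k`-module with
commuting `k`-linear actions of `A` (from the left) and of `B` (from the right; since `B` is
commutative, a right action is a homomorphism into the endomorphism ring as well). -/
structure CentralBimodule (k A B : Type*) [CommRing k] [CommRing A] [CommRing B]
    [Algebra k A] [Algebra k B] where
  carrier : Type u
  [addCommGroup : AddCommGroup carrier]
  [module : Module k carrier]
  /-- `left a v` is `a · v`. -/
  left : A →ₐ[k] Module.End k carrier
  /-- `right b v` is `v · b`. -/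
  right : B →ₐ[k] Module.End k carrier
  left_right : ∀ a b v, left a (right b v) = right b (left a v)

namespace CentralBimodule

attribute [instance] addCommGroup module

instance (k A B : Type*) [CommRing k] [CommRing A] [CommRing B] [Algebra k A] [Algebra k B] :
    CoeSort (CentralBimodule.{u} k A B) (Type u) := ⟨carrier⟩

section Basic

variable {k A B C D : Type*} [CommRing k] [CommRing A] [CommRing B] [CommRing C] [CommRing D]
  [Algebra k A] [Algebra k B] [Algebra k C] [Algebra k D]

/-- The left `A`-module underlying a bimodule. -/
abbrev leftModule (V : CentralBimodule.{u} k A B) : Module A V :=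
  Module.compHom V V.left.toRingHom

/-- The right `B`-module underlying a bimodule. -/
abbrev rightModule (V : CentralBimodule.{u} k A B) : Module B V :=
  Module.compHom V V.right.toRingHom

/-- `V` is finitely generated as a left module. -/
def LeftFinite (V : CentralBimodule.{u} k A B) : Prop :=
  letI := V.leftModule
  Module.Finite A V

/-- `V` is finitely generated as a right module. -/
def RightFinite (V : CentralBimodule.{u} k A B) : Prop :=
  letI := V.rightModule
  Module.Finite B V

/-- A `k`-linear map is a homomorphism of bimodules. -/
def IsHom {V W : CentralBimodule.{u} k A B} (f : V →ₗ[k] W) : Prop :=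
  (∀ a v, f (V.left a v) = W.left a (f v)) ∧ ∀ b v, f (V.right b v) = W.right b (f v)

/-- The bimodules `V` and `W` are isomorphic. -/
def Isomorphic (V W : CentralBimodule.{u} k A B) : Prop :=
  ∃ e : V ≃ₗ[k] W, IsHom e.toLinearMap

/-- There is a short exact sequence of bimodules `0 → U → V → W → 0`. -/
def ShortExact (U V W : CentralBimodule.{u} k A B) : Prop :=
  ∃ (f : U →ₗ[k] V) (g : V →ₗ[k] W), IsHom f ∧ IsHom g ∧
    Function.Injective f ∧ Function.Exact f g ∧ Function.Surjective g

/-- The `B`-`A`-bimodule `B_φ` of a homomorphism `φ : A → B`, with `b · x · a = b x φ(a)`. -/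
def ofHom {A : Type*} {B : Type u} [CommRing A] [CommRing B] [Algebra k A] [Algebra k B]
    (φ : A →ₐ[k] B) : CentralBimodule.{u} k B A where
  carrier := B
  left := Algebra.lmul k B
  right := (Algebra.lmul k B).comp φ
  left_right a b v := mul_left_comm a (φ b) v

/-- Restriction of scalars along `α : A → B` on the left and `β : D → C` on the right. -/
def restrict (V : CentralBimodule.{u} k B C) (α : A →ₐ[k] B) (β : D →ₐ[k] C) :
    CentralBimodule.{u} k A D where
  carrier := V
  left := V.left.comp α
  right := V.right.comp β
  left_right a b v := V.left_right (α a) (β b) v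

/-- The direct sum of finitely many bimodules. -/
def directSum {n : ℕ} (V : Fin n → CentralBimodule.{u} k A B) : CentralBimodule.{u} k A B where
  carrier := ∀ i, V i
  left := AlgHom.ofLinearMap
    { toFun := fun a ↦ LinearMap.pi fun i ↦ (V i).left a ∘ₗ LinearMap.proj i
      map_add' := fun a b ↦ by ext; simp
      map_smul' := fun a b ↦ by ext; simp }
    (by ext; simp) (fun a b ↦ by ext; simp)
  right := AlgHom.ofLinearMap
    { toFun := fun a ↦ LinearMap.pi fun i ↦ (V i).right a ∘ₗ LinearMap.proj i
      map_add' := fun a b ↦ by ext; simp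
      map_smul' := fun a b ↦ by ext; simp }
    (by ext; simp) (fun a b ↦ by ext; simp)
  left_right a b v := funext fun i ↦ (V i).left_right a b (v i)

/-- The relations `v b ⊗ w = v ⊗ b w` in `V ⊗[k] W`. -/
def tensorRel (V : CentralBimodule.{u} k A B) (W : CentralBimodule.{u} k B C) :
    Submodule k (V ⊗[k] W) :=
  Submodule.span k {x | ∃ v b w, x = V.right b v ⊗ₜ[k] w - v ⊗ₜ[k] W.left b w}

lemma tensorRel_le_left (V : CentralBimodule.{u} k A B) (W : CentralBimodule.{u} k B C) (a : A) :
    tensorRel V W ≤ (tensorRel V W).comap (LinearMap.rTensor W (V.left a)) := by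
  refine Submodule.span_le.2 ?_
  rintro _ ⟨v, b, w, rfl⟩
  refine Submodule.subset_span ⟨V.left a v, b, w, ?_⟩
  simp [V.left_right]

lemma tensorRel_le_right (V : CentralBimodule.{u} k A B) (W : CentralBimodule.{u} k B C) (c : C) :
    tensorRel V W ≤ (tensorRel V W).comap (LinearMap.lTensor V (W.right c)) := by
  refine Submodule.span_le.2 ?_
  rintro _ ⟨v, b, w, rfl⟩
  refine Submodule.subset_span ⟨v, b, W.right c w, ?_⟩
  simp [W.left_right]

/-- The quotient of `V ⊗[k] W` by the relations `v b ⊗ w = v ⊗ b w`. -/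
def TensorCarrier (V : CentralBimodule.{u} k A B) (W : CentralBimodule.{u} k B C) : Type u :=
  (V ⊗[k] W) ⧸ tensorRel V W

instance (V : CentralBimodule.{u} k A B) (W : CentralBimodule.{u} k B C) :
    AddCommGroup (TensorCarrier V W) :=
  inferInstanceAs (AddCommGroup ((V ⊗[k] W) ⧸ tensorRel V W))

instance (V : CentralBimodule.{u} k A B) (W : CentralBimodule.{u} k B C) :
    Module k (TensorCarrier V W) :=
  inferInstanceAs (Module k ((V ⊗[k] W) ⧸ tensorRel V W))

/-- The quotient map. -/
def tensorMk (V : CentralBimodule.{u} k A B) (W : CentralBimodule.{u} k B C) :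
    V ⊗[k] W →ₗ[k] TensorCarrier V W := (tensorRel V W).mkQ

lemma tensorMk_surjective (V : CentralBimodule.{u} k A B) (W : CentralBimodule.{u} k B C) :
    Function.Surjective (tensorMk V W) := Submodule.mkQ_surjective _

lemma tensorMk_hom_ext {V : CentralBimodule.{u} k A B} {W : CentralBimodule.{u} k B C}
    {M : Type*} [AddCommGroup M] [Module k M] {f g : TensorCarrier V W →ₗ[k] M}
    (h : ∀ v w, f (tensorMk V W (v ⊗ₜ w)) = g (tensorMk V W (v ⊗ₜ w))) : f = g := by
  have : f ∘ₗ tensorMk V W = g ∘ₗ tensorMk V W := TensorProduct.ext' h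
  ext x
  obtain ⟨x, rfl⟩ := tensorMk_surjective V W x
  exact LinearMap.congr_fun this x

/-- `v ⊗ w ↦ a v ⊗ w`. -/
def tensorLeft (V : CentralBimodule.{u} k A B) (W : CentralBimodule.{u} k B C) (a : A) :
    TensorCarrier V W →ₗ[k] TensorCarrier V W :=
  (tensorRel V W).mapQ _ _ (tensorRel_le_left V W a)

/-- `v ⊗ w ↦ v ⊗ w c`. -/
def tensorRight (V : CentralBimodule.{u} k A B) (W : CentralBimodule.{u} k B C) (c : C) :
    TensorCarrier V W →ₗ[k] TensorCarrier V W :=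
  (tensorRel V W).mapQ _ _ (tensorRel_le_right V W c)

lemma tensorLeft_mk (V : CentralBimodule.{u} k A B) (W : CentralBimodule.{u} k B C) (a : A) (v w) :
    tensorLeft V W a (tensorMk V W (v ⊗ₜ w)) = tensorMk V W (V.left a v ⊗ₜ w) := rfl

lemma tensorRight_mk (V : CentralBimodule.{u} k A B) (W : CentralBimodule.{u} k B C) (c : C)
    (v w) : tensorRight V W c (tensorMk V W (v ⊗ₜ w)) = tensorMk V W (v ⊗ₜ W.right c w) := rfl

/-- The tensor product `V ⊗_B W` of an `A`-`B`-bimodule and a `B`-`C`-bimodule, with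
`a · (v ⊗ w) · c = a v ⊗ w c`. -/
def tensor (V : CentralBimodule.{u} k A B) (W : CentralBimodule.{u} k B C) :
    CentralBimodule.{u} k A C where
  carrier := TensorCarrier V W
  left := AlgHom.ofLinearMap
    { toFun := tensorLeft V W
      map_add' := fun a b ↦ tensorMk_hom_ext fun v w ↦ by
        rw [LinearMap.add_apply]
        simp only [tensorLeft_mk, map_add, LinearMap.add_apply, TensorProduct.add_tmul]
      map_smul' := fun a b ↦ tensorMk_hom_ext fun v w ↦ by
        rw [RingHom.id_apply, LinearMap.smul_apply]
        simp only [tensorLeft_mk, map_smul, LinearMap.smul_apply, ← TensorProduct.smul_tmul'] }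
    (tensorMk_hom_ext fun v w ↦ by
      change tensorLeft V W 1 _ = _
      rw [tensorLeft_mk, map_one]; rfl)
    (fun a b ↦ tensorMk_hom_ext fun v w ↦ by
      rw [Module.End.mul_apply]
      change tensorLeft V W (a * b) (tensorMk V W (v ⊗ₜ w)) =
        tensorLeft V W a (tensorLeft V W b (tensorMk V W (v ⊗ₜ w)))
      rw [tensorLeft_mk, map_mul]; rfl)
  right := AlgHom.ofLinearMap
    { toFun := tensorRight V W
      map_add' := fun a b ↦ tensorMk_hom_ext fun v w ↦ by
        rw [LinearMap.add_apply]
        simp only [tensorRight_mk, map_add, LinearMap.add_apply, TensorProduct.tmul_add]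
      map_smul' := fun a b ↦ tensorMk_hom_ext fun v w ↦ by
        rw [RingHom.id_apply, LinearMap.smul_apply]
        simp only [tensorRight_mk, map_smul, LinearMap.smul_apply, TensorProduct.tmul_smul] }
    (tensorMk_hom_ext fun v w ↦ by
      change tensorRight V W 1 _ = _
      rw [tensorRight_mk, map_one]; rfl)
    (fun a b ↦ tensorMk_hom_ext fun v w ↦ by
      rw [Module.End.mul_apply]
      change tensorRight V W (a * b) (tensorMk V W (v ⊗ₜ w)) =
        tensorRight V W a (tensorRight V W b (tensorMk V W (v ⊗ₜ w)))
      rw [tensorRight_mk, map_mul]; rfl)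
  left_right a c x := by
    have : tensorLeft V W a ∘ₗ tensorRight V W c = tensorRight V W c ∘ₗ tensorLeft V W a :=
      tensorMk_hom_ext fun v w ↦ rfl
    exact LinearMap.congr_fun this x

section Tensor

variable {V : CentralBimodule.{u} k A B} {W : CentralBimodule.{u} k B C}

/-- The element `v ⊗ w` of `V ⊗_B W`. -/
def tmul (v : V) (w : W) : V.tensor W := tensorMk V W (v ⊗ₜ[k] w)

lemma left_tmul (a : A) (v : V) (w : W) : (V.tensor W).left a (tmul v w) = tmul (V.left a v) w :=
  rfl

lemma right_tmul (c : C) (v : V) (w : W) :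
    (V.tensor W).right c (tmul v w) = tmul v (W.right c w) := rfl

lemma tmul_balanced (v : V) (b : B) (w : W) : tmul (V.right b v) w = tmul v (W.left b w) := by
  exact (Submodule.Quotient.eq _).2 (Submodule.subset_span ⟨v, b, w, rfl⟩)

lemma add_tmul (v v' : V) (w : W) : tmul (v + v') w = tmul v w + tmul v' w :=
  (congrArg (tensorMk V W) (TensorProduct.add_tmul v v' w)).trans (map_add _ _ _)

lemma tmul_add (v : V) (w w' : W) : tmul v (w + w') = tmul v w + tmul v w' :=
  (congrArg (tensorMk V W) (TensorProduct.tmul_add v w w')).trans (map_add _ _ _)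

lemma smul_tmul (c : k) (v : V) (w : W) : tmul (c • v) w = c • tmul v w := rfl

lemma tmul_smul (c : k) (v : V) (w : W) : tmul v (c • w) = c • tmul v w :=
  (congrArg (tensorMk V W) (TensorProduct.tmul_smul c v w)).trans (map_smul _ _ _)

variable (V W) in
/-- The bilinear map `(v, w) ↦ v ⊗ w`. -/
def tmulₗ : V →ₗ[k] W →ₗ[k] V.tensor W :=
  LinearMap.mk₂ k tmul add_tmul smul_tmul tmul_add tmul_smul

@[simp] lemma tmulₗ_apply (v : V) (w : W) : tmulₗ V W v w = tmul v w := rfl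

@[elab_as_elim]
lemma tensor_induction {p : V.tensor W → Prop} (x : V.tensor W) (zero : p 0)
    (tmul : ∀ v w, p (tmul v w)) (add : ∀ x y, p x → p y → p (x + y)) : p x := by
  obtain ⟨x, rfl⟩ := tensorMk_surjective V W x
  induction x with
  | zero => rw [map_zero]; exact zero
  | tmul v w => exact tmul v w
  | add x y hx hy => rw [map_add]; exact add _ _ hx hy

/-- The linear map out of `V ⊗_B W` given by a `B`-balanced bilinear map. -/
def tensorLift {M : Type*} [AddCommGroup M] [Module k M] (f : V →ₗ[k] W →ₗ[k] M)
    (hf : ∀ v b w, f (V.right b v) w = f v (W.left b w)) : V.tensor W →ₗ[k] M :=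
  (tensorRel V W).liftQ (TensorProduct.lift f) (Submodule.span_le.2 (by
    rintro _ ⟨v, b, w, rfl⟩
    simp [hf]))

@[simp] lemma tensorLift_tmul {M : Type*} [AddCommGroup M] [Module k M] (f : V →ₗ[k] W →ₗ[k] M)
    (hf : ∀ v b w, f (V.right b v) w = f v (W.left b w)) (v : V) (w : W) :
    tensorLift f hf (tmul v w) = f v w := rfl

lemma tensor_hom_ext {M : Type*} [AddCommGroup M] [Module k M] {f g : V.tensor W →ₗ[k] M}
    (h : ∀ v w, f (tmul v w) = g (tmul v w)) : f = g := by
  refine LinearMap.ext fun x ↦ ?_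
  induction x using tensor_induction with
  | zero => rw [map_zero, map_zero]
  | tmul v w => exact h v w
  | add x y hx hy => rw [map_add, map_add, hx, hy]

lemma tensor_hom_ext_left {X : CentralBimodule.{u} k C D} {M : Type*} [AddCommGroup M]
    [Module k M] {f g : (V.tensor W).tensor X →ₗ[k] M}
    (h : ∀ v w x, f (tmul (tmul v w) x) = g (tmul (tmul v w) x)) : f = g := by
  refine tensor_hom_ext fun y x ↦ ?_
  have : f ∘ₗ (tmulₗ (V.tensor W) X).flip x = g ∘ₗ (tmulₗ (V.tensor W) X).flip x :=
    tensor_hom_ext fun v w ↦ h v w x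
  exact LinearMap.congr_fun this y

lemma tensor_hom_ext_right {X : CentralBimodule.{u} k C D} {M : Type*} [AddCommGroup M]
    [Module k M] {f g : V.tensor (W.tensor X) →ₗ[k] M}
    (h : ∀ v w x, f (tmul v (tmul w x)) = g (tmul v (tmul w x))) : f = g := by
  refine tensor_hom_ext fun v y ↦ ?_
  have : f ∘ₗ tmulₗ V (W.tensor X) v = g ∘ₗ tmulₗ V (W.tensor X) v :=
    tensor_hom_ext fun w x ↦ h v w x
  exact LinearMap.congr_fun this y

/-- The map `f ⊗ g`, for `f` compatible with the right and `g` with the left actions of `B`. -/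
def tensorMap {V' : CentralBimodule.{u} k D B} {E : Type*} [CommRing E] [Algebra k E]
    {W' : CentralBimodule.{u} k B E} (f : V →ₗ[k] V') (g : W →ₗ[k] W')
    (hf : ∀ b v, f (V.right b v) = V'.right b (f v))
    (hg : ∀ b w, g (W.left b w) = W'.left b (g w)) : V.tensor W →ₗ[k] V'.tensor W' :=
  tensorLift ((tmulₗ V' W').compl₁₂ f g) (fun v b w ↦ by
    simp only [LinearMap.compl₁₂_apply, tmulₗ_apply, hf, hg, tmul_balanced])

@[simp] lemma tensorMap_tmul {V' : CentralBimodule.{u} k D B} {E : Type*} [CommRing E]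
    [Algebra k E] {W' : CentralBimodule.{u} k B E} (f : V →ₗ[k] V') (g : W →ₗ[k] W')
    (hf : ∀ b v, f (V.right b v) = V'.right b (f v))
    (hg : ∀ b w, g (W.left b w) = W'.left b (g w)) (v : V) (w : W) :
    tensorMap f g hf hg (tmul v w) = tmul (f v) (g w) := rfl

end Tensor

/-- The additive group generated by the left multiples of a set is everything. -/
lemma leftFinite_iff (V : CentralBimodule.{u} k A B) : V.LeftFinite ↔
    ∃ s : Finset V, ∀ v, v ∈ AddSubgroup.closure {x : V | ∃ a, ∃ y ∈ s, x = V.left a y} := by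
  let := V.leftModule
  constructor
  · rintro ⟨s, hs⟩
    refine ⟨s, fun v ↦ ?_⟩
    have hv : v ∈ Submodule.span A (s : Set V) := by rw [hs]; trivial
    induction hv using Submodule.span_induction with
    | mem x hx => exact AddSubgroup.subset_closure ⟨1, x, hx, by simp⟩
    | zero => exact zero_mem _
    | add x y _ _ hx hy => exact add_mem hx hy
    | smul a x _ hx =>
      have : AddSubgroup.closure {x : V | ∃ a, ∃ y ∈ s, x = V.left a y} ≤
          (AddSubgroup.closure {x : V | ∃ a, ∃ y ∈ s, x = V.left a y}).comap
            (V.left a).toAddMonoidHom := by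
        refine (AddSubgroup.closure_le _).2 ?_
        rintro _ ⟨a', y, hy, rfl⟩
        exact AddSubgroup.subset_closure ⟨a * a', y, hy, by simp⟩
      exact this hx
  · rintro ⟨s, hs⟩
    refine ⟨s, eq_top_iff.2 fun v _ ↦ ?_⟩
    have : AddSubgroup.closure {x : V | ∃ a, ∃ y ∈ s, x = V.left a y} ≤
        (Submodule.span A (s : Set V)).toAddSubgroup := by
      refine (AddSubgroup.closure_le _).2 ?_
      rintro _ ⟨a, y, hy, rfl⟩
      exact Submodule.smul_mem _ a (Submodule.subset_span hy)
    exact this (hs v)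

/-- The same bimodule with the two sides exchanged. -/
def swap (V : CentralBimodule.{u} k A B) : CentralBimodule.{u} k B A where
  carrier := V
  left := V.right
  right := V.left
  left_right a b v := (V.left_right b a v).symm

lemma rightFinite_iff (V : CentralBimodule.{u} k A B) : V.RightFinite ↔
    ∃ s : Finset V, ∀ v, v ∈ AddSubgroup.closure {x : V | ∃ b, ∃ y ∈ s, x = V.right b y} :=
  leftFinite_iff V.swap

lemma LeftFinite.tensor {V : CentralBimodule.{u} k A B} {W : CentralBimodule.{u} k B C}
    (hV : V.LeftFinite) (hW : W.LeftFinite) : (V.tensor W).LeftFinite := by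
  classical
  obtain ⟨s, hs⟩ := (leftFinite_iff V).1 hV
  obtain ⟨t, ht⟩ := (leftFinite_iff W).1 hW
  refine (leftFinite_iff _).2 ⟨Finset.image₂ tmul s t, fun x ↦ ?_⟩
  refine tensor_induction x (zero_mem _) (fun v w ↦ ?_) (fun x y hx hy ↦ add_mem hx hy)
  have hw := ht w
  induction hw using AddSubgroup.closure_induction generalizing v with
  | mem w hw =>
    obtain ⟨b, w, hw, rfl⟩ := hw
    rw [← tmul_balanced]
    have hv := hs (V.right b v)
    generalize V.right b v = v at hv
    induction hv using AddSubgroup.closure_induction with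
    | mem v hv =>
      obtain ⟨a, v, hv, rfl⟩ := hv
      exact AddSubgroup.subset_closure ⟨a, tmul v w, Finset.mem_image₂_of_mem hv hw, rfl⟩
    | zero => rw [← tmulₗ_apply, map_zero]; exact zero_mem _
    | add x y _ _ hx hy => rw [add_tmul]; exact add_mem hx hy
    | neg x _ hx => rw [← tmulₗ_apply, map_neg]; exact neg_mem hx
  | zero => rw [← tmulₗ_apply, map_zero]; exact zero_mem _
  | add x y _ _ hx hy => rw [tmul_add]; exact add_mem (hx _) (hy _)
  | neg x _ hx => rw [← tmulₗ_apply, map_neg]; exact neg_mem (hx _)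

lemma RightFinite.tensor {V : CentralBimodule.{u} k A B} {W : CentralBimodule.{u} k B C}
    (hV : V.RightFinite) (hW : W.RightFinite) : (V.tensor W).RightFinite := by
  classical
  obtain ⟨s, hs⟩ := (rightFinite_iff V).1 hV
  obtain ⟨t, ht⟩ := (rightFinite_iff W).1 hW
  refine (rightFinite_iff _).2 ⟨Finset.image₂ tmul s t, fun x ↦ ?_⟩
  refine tensor_induction x (zero_mem _) (fun v w ↦ ?_) (fun x y hx hy ↦ add_mem hx hy)
  have hv := hs v
  induction hv using AddSubgroup.closure_induction generalizing w with
  | mem v hv =>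
    obtain ⟨b, v, hv, rfl⟩ := hv
    rw [tmul_balanced]
    have hw := ht (W.left b w)
    generalize W.left b w = w at hw
    induction hw using AddSubgroup.closure_induction with
    | mem w hw =>
      obtain ⟨a, w, hw, rfl⟩ := hw
      exact AddSubgroup.subset_closure ⟨a, tmul v w, Finset.mem_image₂_of_mem hv hw, rfl⟩
    | zero => rw [← tmulₗ_apply, map_zero]; exact zero_mem _
    | add x y _ _ hx hy => rw [tmul_add]; exact add_mem hx hy
    | neg x _ hx => rw [← tmulₗ_apply, map_neg]; exact neg_mem hx
  | zero => rw [← tmulₗ_apply, map_zero]; exact zero_mem _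
  | add x y _ _ hx hy => rw [add_tmul]; exact add_mem (hx _) (hy _)
  | neg x _ hx => rw [← tmulₗ_apply, map_neg]; exact neg_mem (hx _)

lemma ofHom_leftFinite {A : Type*} {B : Type u} [CommRing A] [CommRing B] [Algebra k A]
    [Algebra k B] (φ : A →ₐ[k] B) : (ofHom φ).LeftFinite :=
  (leftFinite_iff _).2 ⟨({(1 : B)} : Finset B), fun (v : B) ↦
    AddSubgroup.subset_closure ⟨v, (1 : B), Finset.mem_singleton_self _, (mul_one v).symm⟩⟩

/-- An isomorphism built from two mutually inverse maps. -/
lemma Isomorphic.of_inverse {V W : CentralBimodule.{u} k A B} (f : V →ₗ[k] W) (g : W →ₗ[k] V)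
    (hfg : f ∘ₗ g = LinearMap.id) (hgf : g ∘ₗ f = LinearMap.id)
    (hl : ∀ a, f ∘ₗ V.left a = W.left a ∘ₗ f) (hr : ∀ b, f ∘ₗ V.right b = W.right b ∘ₗ f) :
    V.Isomorphic W :=
  ⟨{ f with
      invFun := g
      left_inv := LinearMap.congr_fun hgf
      right_inv := LinearMap.congr_fun hfg },
    fun a ↦ LinearMap.congr_fun (hl a), fun b ↦ LinearMap.congr_fun (hr b)⟩

/-- The associativity isomorphism. -/
lemma tensor_assoc (V : CentralBimodule.{u} k A B) (W : CentralBimodule.{u} k B C)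
    (X : CentralBimodule.{u} k C D) :
    ((V.tensor W).tensor X).Isomorphic (V.tensor (W.tensor X)) := by
  let f₀ : V.tensor W →ₗ[k] X →ₗ[k] V.tensor (W.tensor X) :=
    tensorLift
      (LinearMap.mk₂ k (fun v w ↦ tmulₗ V (W.tensor X) v ∘ₗ tmulₗ W X w)
        (fun v v' w ↦ by ext x; exact add_tmul _ _ _)
        (fun c v w ↦ by ext x; exact smul_tmul _ _ _)
        (fun v w w' ↦ by
          ext x; exact (congrArg (tmul v) (add_tmul w w' x)).trans (tmul_add _ _ _))
        (fun c v w ↦ by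
          ext x; exact (congrArg (tmul v) (smul_tmul c w x)).trans (tmul_smul _ _ _)))
      (fun v b w ↦ by ext x; exact tmul_balanced v b (tmul w x))
  have hf₀ : ∀ c x, f₀.flip x ∘ₗ (V.tensor W).right c = f₀.flip (X.left c x) := fun c x ↦
    tensor_hom_ext fun v w ↦ congrArg (tmul v) (tmul_balanced w c x)
  let f : (V.tensor W).tensor X →ₗ[k] V.tensor (W.tensor X) :=
    tensorLift f₀ (fun y c x ↦ LinearMap.congr_fun (hf₀ c x) y)
  let g₀ : W.tensor X →ₗ[k] V →ₗ[k] (V.tensor W).tensor X :=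
    tensorLift
      (LinearMap.mk₂ k (fun w x ↦ (tmulₗ (V.tensor W) X).flip x ∘ₗ (tmulₗ V W).flip w)
        (fun w w' x ↦ by
          ext v; exact (congrArg (tmul · x) (tmul_add v w w')).trans (add_tmul _ _ _))
        (fun c w x ↦ by
          ext v; exact (congrArg (tmul · x) (tmul_smul c v w)).trans (smul_tmul _ _ _))
        (fun w x x' ↦ by ext v; exact tmul_add _ _ _)
        (fun c w x ↦ by ext v; exact tmul_smul _ _ _))
      (fun w c x ↦ by ext v; exact tmul_balanced (tmul v w) c x)
  have hg₀ : ∀ v b, g₀.flip (V.right b v) = g₀.flip v ∘ₗ (W.tensor X).left b := fun v b ↦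
    tensor_hom_ext fun w x ↦ congrArg (tmul · x) (tmul_balanced v b w)
  let g : V.tensor (W.tensor X) →ₗ[k] (V.tensor W).tensor X :=
    tensorLift g₀.flip (fun v b y ↦ LinearMap.congr_fun (hg₀ v b) y)
  exact .of_inverse f g (tensor_hom_ext_right fun v w x ↦ rfl)
    (tensor_hom_ext_left fun v w x ↦ rfl) (fun a ↦ tensor_hom_ext_left fun v w x ↦ rfl)
    (fun a ↦ tensor_hom_ext_left fun v w x ↦ rfl)

/-- `A ⊗_A V ≅ V`. -/
lemma unit_tensor {A : Type u} [CommRing A] [Algebra k A] (V : CentralBimodule.{u} k A B) :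
    ((ofHom (AlgHom.id k A)).tensor V).Isomorphic V := by
  let f : (ofHom (AlgHom.id k A)).tensor V →ₗ[k] V :=
    tensorLift (V := ofHom (AlgHom.id k A)) V.left.toLinearMap (fun (x : A) b w ↦ by
      change V.left (b * x) w = V.left x (V.left b w)
      rw [mul_comm, map_mul]; rfl)
  let g : V →ₗ[k] (ofHom (AlgHom.id k A)).tensor V := tmulₗ (ofHom (AlgHom.id k A)) V (1 : A)
  refine .of_inverse f g ?_ ?_ (fun a ↦ ?_) (fun a ↦ ?_)
  · ext v
    change V.left 1 v = v
    rw [map_one]; rfl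
  · refine tensor_hom_ext fun (x : A) v ↦ ?_
    refine (tmul_balanced (V := ofHom (AlgHom.id k A)) (1 : A) x v).symm.trans ?_
    exact congrArg (fun y ↦ tmul (V := ofHom (AlgHom.id k A)) y v) (mul_one x)
  · refine tensor_hom_ext fun (x : A) v ↦ ?_
    change V.left (a * x) v = V.left a (V.left x v)
    rw [map_mul]; rfl
  · exact tensor_hom_ext fun (x : A) v ↦ V.left_right x a v

/-- `V ⊗_B B ≅ V`. -/
lemma tensor_unit {B : Type u} [CommRing B] [Algebra k B] (V : CentralBimodule.{u} k A B) :
    (V.tensor (ofHom (AlgHom.id k B))).Isomorphic V := by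
  let f : V.tensor (ofHom (AlgHom.id k B)) →ₗ[k] V :=
    tensorLift (W := ofHom (AlgHom.id k B)) V.right.toLinearMap.flip (fun v b (x : B) ↦ by
      change V.right x (V.right b v) = V.right (b * x) v
      rw [mul_comm, map_mul]; rfl)
  let g : V →ₗ[k] V.tensor (ofHom (AlgHom.id k B)) :=
    (tmulₗ V (ofHom (AlgHom.id k B))).flip (1 : B)
  refine .of_inverse f g ?_ ?_ (fun a ↦ ?_) (fun a ↦ ?_)
  · ext v
    change V.right 1 v = v
    rw [map_one]; rfl
  · refine tensor_hom_ext fun v (x : B) ↦ ?_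
    refine (tmul_balanced (W := ofHom (AlgHom.id k B)) v x (1 : B)).trans ?_
    exact congrArg (fun y ↦ tmul (W := ofHom (AlgHom.id k B)) v y) (mul_one x)
  · exact tensor_hom_ext fun v (x : B) ↦ (V.left_right a x v).symm
  · refine tensor_hom_ext fun v (x : B) ↦ ?_
    change V.right (a * x) v = V.right a (V.right x v)
    rw [map_mul]; rfl

end Basic

section Exact

variable {k A B C : Type*} [CommRing k] [CommRing A] [CommRing B] [CommRing C]
  [Algebra k A] [Algebra k B] [Algebra k C]

lemma right_algebraMap (V : CentralBimodule.{u} k A B) (c : k) (v : V) :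
    V.right (algebraMap k B c) v = c • v := by
  rw [AlgHom.commutes, Module.algebraMap_end_apply]

lemma left_algebraMap (V : CentralBimodule.{u} k A B) (c : k) (v : V) :
    V.left (algebraMap k A c) v = c • v := by
  rw [AlgHom.commutes, Module.algebraMap_end_apply]

variable {F : Type*} [Field F] [Algebra k F]

lemma exists_right_section {V W : CentralBimodule.{u} k A F} (g : V →ₗ[k] W) (hg : IsHom g)
    (hs : Function.Surjective g) : ∃ s : W →ₗ[k] V, (∀ b w, s (W.right b w) = V.right b (s w)) ∧
      ∀ w, g (s w) = w := by
  let := V.rightModule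
  let := W.rightModule
  let g' : V →ₗ[F] W := { g with map_smul' := hg.2 }
  obtain ⟨s, h⟩ := g'.exists_rightInverse_of_surjective (LinearMap.range_eq_top.2 hs)
  refine ⟨{ s with map_smul' := fun c w ↦ ?_ }, s.map_smul, LinearMap.congr_fun h⟩
  rw [← right_algebraMap]
  exact (s.map_smul _ _).trans (right_algebraMap V c _)

lemma exists_right_retraction {V W : CentralBimodule.{u} k A F} (g : V →ₗ[k] W) (hg : IsHom g)
    (hs : Function.Injective g) : ∃ s : W →ₗ[k] V, (∀ b w, s (W.right b w) = V.right b (s w)) ∧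
      ∀ v, s (g v) = v := by
  let := V.rightModule
  let := W.rightModule
  let g' : V →ₗ[F] W := { g with map_smul' := hg.2 }
  obtain ⟨s, h⟩ := g'.exists_leftInverse_of_injective (LinearMap.ker_eq_bot.2 hs)
  refine ⟨{ s with map_smul' := fun c w ↦ ?_ }, s.map_smul, LinearMap.congr_fun h⟩
  rw [← right_algebraMap]
  exact (s.map_smul _ _).trans (right_algebraMap V c _)

lemma exists_right_splitting {U V W : CentralBimodule.{u} k A F} {f : U →ₗ[k] V} {g : V →ₗ[k] W}
    (hf : IsHom f) (hg : IsHom g) (hi : Function.Injective f) (he : Function.Exact f g)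
    (hs : Function.Surjective g) : ∃ (p : V →ₗ[k] U) (s : W →ₗ[k] V),
      (∀ b v, p (V.right b v) = U.right b (p v)) ∧ (∀ b w, s (W.right b w) = V.right b (s w)) ∧
      (∀ u, p (f u) = u) ∧ (∀ w, g (s w) = w) ∧ ∀ v, f (p v) + s (g v) = v := by
  obtain ⟨p, hp, hpf⟩ := exists_right_retraction f hf hi
  obtain ⟨s, hs, hgs⟩ := exists_right_section g hg hs
  refine ⟨p ∘ₗ (LinearMap.id - s ∘ₗ g), s, fun b v ↦ ?_, hs, fun u ↦ ?_, hgs, fun v ↦ ?_⟩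
  · simp [hg.2, hs, hp]
  · simp [he.apply_apply_eq_zero, hpf]
  · have : g (v - s (g v)) = 0 := by rw [map_sub, hgs, sub_self]
    obtain ⟨u, hu⟩ := (he _).1 this
    have : f (p (v - s (g v))) = v - s (g v) := by rw [← hu, hpf]
    simp only [LinearMap.comp_apply, LinearMap.sub_apply, LinearMap.id_apply, this,
      sub_add_cancel]

lemma exact_of_splitting {M N P : Type*} [AddCommGroup M] [AddCommGroup N] [AddCommGroup P]
    [Module k M] [Module k N] [Module k P] {f : M →ₗ[k] N} {g : N →ₗ[k] P} {p : N →ₗ[k] M}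
    {s : P →ₗ[k] N} (hpf : p ∘ₗ f = LinearMap.id) (hgs : g ∘ₗ s = LinearMap.id)
    (hgf : g ∘ₗ f = 0) (h : f ∘ₗ p + s ∘ₗ g = LinearMap.id) :
    Function.Injective f ∧ Function.Exact f g ∧ Function.Surjective g := by
  refine ⟨Function.LeftInverse.injective (LinearMap.congr_fun hpf), fun x ↦ ⟨fun hx ↦ ?_, ?_⟩,
    Function.RightInverse.surjective (LinearMap.congr_fun hgs)⟩
  · refine ⟨p x, ?_⟩
    have := LinearMap.congr_fun h x
    simpa [hx] using this
  · rintro ⟨y, rfl⟩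
    exact LinearMap.congr_fun hgf y

lemma isHom_tensorMap {V W : CentralBimodule.{u} k A B} {f : V →ₗ[k] W} (hf : IsHom f)
    (X : CentralBimodule.{u} k B C) : IsHom (V := V.tensor X) (W := W.tensor X)
      (tensorMap f (LinearMap.id : X →ₗ[k] X) hf.2 fun _ _ ↦ rfl) := by
  refine ⟨fun a v ↦ ?_, fun a v ↦ ?_⟩
  · induction v using tensor_induction with
    | zero => simp only [map_zero]
    | tmul v x => exact congrArg (tmul · x) (hf.1 a v)
    | add x y hx hy => rw [map_add, map_add, map_add, map_add, hx, hy]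
  · induction v using tensor_induction with
    | zero => simp only [map_zero]
    | tmul v x => rfl
    | add x y hx hy => rw [map_add, map_add, map_add, map_add, hx, hy]

lemma ShortExact.tensor_right {U V W : CentralBimodule.{u} k A F} (h : ShortExact U V W)
    (X : CentralBimodule.{u} k F C) : ShortExact (U.tensor X) (V.tensor X) (W.tensor X) := by
  obtain ⟨f, g, hf, hg, hi, he, hs⟩ := h
  obtain ⟨p, s, hp, hs', hpf, hgs, hfs⟩ := exists_right_splitting hf hg hi he hs
  refine ⟨tensorMap f LinearMap.id hf.2 fun _ _ ↦ rfl, tensorMap g LinearMap.id hg.2 fun _ _ ↦ rfl,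
    isHom_tensorMap hf X, isHom_tensorMap hg X,
    exact_of_splitting (p := tensorMap p LinearMap.id hp fun _ _ ↦ rfl)
      (s := tensorMap s LinearMap.id hs' fun _ _ ↦ rfl)
      (tensor_hom_ext fun v x ↦ congrArg (tmul · x) (hpf v))
      (tensor_hom_ext fun v x ↦ congrArg (tmul · x) (hgs v))
      (tensor_hom_ext fun v x ↦ ?_)
      (tensor_hom_ext fun v x ↦ (add_tmul _ _ x).symm.trans (congrArg (tmul · x) (hfs v)))⟩
  refine (congrArg (tmul · x) (he.apply_apply_eq_zero v)).trans ?_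
  exact LinearMap.congr_fun (map_zero (tmulₗ W X)) x

lemma ShortExact.swap {U V W : CentralBimodule.{u} k A B} (h : ShortExact U V W) :
    ShortExact U.swap V.swap W.swap := by
  obtain ⟨f, g, hf, hg, h⟩ := h
  exact ⟨f, g, hf.symm, hg.symm, h⟩

lemma Isomorphic.swap_tensor (V : CentralBimodule.{u} k A B) (W : CentralBimodule.{u} k B C) :
    (W.swap.tensor V.swap).swap.Isomorphic (V.tensor W) := by
  let f : (W.swap.tensor V.swap).swap →ₗ[k] V.tensor W :=
    tensorLift (V := W.swap) (W := V.swap) (tmulₗ V W).flip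
      (fun w b v ↦ (tmul_balanced (V := V) (W := W) v b w).symm)
  let g : V.tensor W →ₗ[k] (W.swap.tensor V.swap).swap :=
    tensorLift (tmulₗ W.swap V.swap).flip
      (fun v b w ↦ (tmul_balanced (V := W.swap) (W := V.swap) w b v).symm)
  exact .of_inverse f g (tensor_hom_ext fun v w ↦ rfl)
    (tensor_hom_ext (V := W.swap) (W := V.swap) fun v w ↦ rfl)
    (fun a ↦ tensor_hom_ext (V := W.swap) (W := V.swap) fun v w ↦ rfl)
    (fun a ↦ tensor_hom_ext (V := W.swap) (W := V.swap) fun v w ↦ rfl)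

lemma IsHom.comp {U V W : CentralBimodule.{u} k A B} {g : V →ₗ[k] W} {f : U →ₗ[k] V}
    (hg : IsHom g) (hf : IsHom f) : IsHom (V := U) (W := W) (g ∘ₗ f) :=
  ⟨fun a v ↦ (congrArg g (hf.1 a v)).trans (hg.1 a _),
    fun a v ↦ (congrArg g (hf.2 a v)).trans (hg.2 a _)⟩

lemma Isomorphic.symm {V W : CentralBimodule.{u} k A B} (h : V.Isomorphic W) :
    W.Isomorphic V := by
  obtain ⟨e, h⟩ := h
  refine ⟨e.symm, fun a w ↦ e.injective ?_, fun a w ↦ e.injective ?_⟩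
  · exact (e.apply_symm_apply _).trans
      ((congrArg _ (e.apply_symm_apply w).symm).trans (h.1 a _).symm)
  · exact (e.apply_symm_apply _).trans
      ((congrArg _ (e.apply_symm_apply w).symm).trans (h.2 a _).symm)

lemma ShortExact.congr {U V W U' V' W' : CentralBimodule.{u} k A B} (h : ShortExact U V W)
    (hU : U.Isomorphic U') (hV : V.Isomorphic V') (hW : W.Isomorphic W') :
    ShortExact U' V' W' := by
  obtain ⟨f, g, hf, hg, hi, he, hs⟩ := h
  obtain ⟨a, ha⟩ := hU.symm
  obtain ⟨b, hb⟩ := hV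
  obtain ⟨c, hc⟩ := hW
  have hbs : IsHom (V := V') (W := V) b.symm.toLinearMap := by
    refine ⟨fun a w ↦ b.injective ?_, fun a w ↦ b.injective ?_⟩
    · exact (b.apply_symm_apply _).trans
        ((congrArg _ (b.apply_symm_apply w).symm).trans (hb.1 a _).symm)
    · exact (b.apply_symm_apply _).trans
        ((congrArg _ (b.apply_symm_apply w).symm).trans (hb.2 a _).symm)
  refine ⟨b.toLinearMap ∘ₗ f ∘ₗ a.toLinearMap, c.toLinearMap ∘ₗ g ∘ₗ b.symm.toLinearMap,
    hb.comp (hf.comp ha), hc.comp (hg.comp hbs), ?_, fun x ↦ ?_, ?_⟩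
  · exact b.injective.comp (hi.comp a.injective)
  · change c (g (b.symm x)) = 0 ↔ ∃ y, b (f (a y)) = x
    rw [LinearEquiv.map_eq_zero_iff, he]
    constructor
    · rintro ⟨y, hy⟩
      exact ⟨a.symm y, by rw [a.apply_symm_apply, hy, b.apply_symm_apply]⟩
    · rintro ⟨y, hy⟩
      exact ⟨a y, by rw [← hy, b.symm_apply_apply]⟩
  · exact c.surjective.comp (hs.comp b.symm.surjective)

lemma ShortExact.tensor_left {U V W : CentralBimodule.{u} k F C} (h : ShortExact U V W)
    (X : CentralBimodule.{u} k A F) : ShortExact (X.tensor U) (X.tensor V) (X.tensor W) :=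
  (h.swap.tensor_right X.swap).swap.congr (.swap_tensor X U) (.swap_tensor X V) (.swap_tensor X W)

end Exact

section Covers

variable {k A B C D : Type*} [CommRing k] [CommRing A] [CommRing B] [CommRing C] [CommRing D]
  [Algebra k A] [Algebra k B] [Algebra k C] [Algebra k D]

/-- `W` is a quotient of `V`. -/
def Covers (V W : CentralBimodule.{u} k A B) : Prop :=
  ∃ f : V →ₗ[k] W, IsHom f ∧ Function.Surjective f

lemma Isomorphic.covers {V W : CentralBimodule.{u} k A B} (h : V.Isomorphic W) : V.Covers W := by
  obtain ⟨e, h⟩ := h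
  exact ⟨e.toLinearMap, h, e.surjective⟩

lemma Covers.trans {U V W : CentralBimodule.{u} k A B} (h : U.Covers V) (h' : V.Covers W) :
    U.Covers W := by
  obtain ⟨f, hf, hs⟩ := h
  obtain ⟨g, hg, hs'⟩ := h'
  exact ⟨g ∘ₗ f, hg.comp hf, hs'.comp hs⟩

lemma Covers.tensor_right {V W : CentralBimodule.{u} k A B} (h : V.Covers W)
    (X : CentralBimodule.{u} k B C) : (V.tensor X).Covers (W.tensor X) := by
  obtain ⟨f, hf, hs⟩ := h
  refine ⟨tensorMap f LinearMap.id hf.2 fun _ _ ↦ rfl,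
    isHom_tensorMap hf X, fun y ↦ ?_⟩
  induction y using tensor_induction with
  | zero => exact ⟨0, map_zero _⟩
  | tmul w x =>
    obtain ⟨v, rfl⟩ := hs w
    exact ⟨tmul v x, rfl⟩
  | add y z hy hz =>
    obtain ⟨y, rfl⟩ := hy
    obtain ⟨z, rfl⟩ := hz
    exact ⟨y + z, map_add _ _ _⟩

lemma Covers.tensor_left {V W : CentralBimodule.{u} k B C} (h : V.Covers W)
    (X : CentralBimodule.{u} k A B) : (X.tensor V).Covers (X.tensor W) := by
  have hs : ∀ {V W : CentralBimodule.{u} k C A}, V.Covers W → V.swap.Covers W.swap := by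
    rintro V W ⟨f, hf, hs⟩
    exact ⟨f, hf.symm, hs⟩
  have h' : V.swap.Covers W.swap := by
    obtain ⟨f, hf, hs⟩ := h
    exact ⟨f, hf.symm, hs⟩
  exact (Isomorphic.swap_tensor X V).symm.covers.trans
    ((hs (h'.tensor_right X.swap)).trans (Isomorphic.swap_tensor X W).covers)

lemma Covers.leftFinite {V W : CentralBimodule.{u} k A B} (h : V.Covers W) (hV : V.LeftFinite) :
    W.LeftFinite := by
  obtain ⟨f, hf, hs⟩ := h
  let := V.leftModule
  let := W.leftModule
  have : Module.Finite A V := hV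
  exact Module.Finite.of_surjective ({ f with map_smul' := hf.1 } : V →ₗ[A] W) hs

lemma Covers.rightFinite {V W : CentralBimodule.{u} k A B} (h : V.Covers W)
    (hV : V.RightFinite) : W.RightFinite := by
  obtain ⟨f, hf, hs⟩ := h
  let := V.rightModule
  let := W.rightModule
  have : Module.Finite B V := hV
  exact Module.Finite.of_surjective ({ f with map_smul' := hf.2 } : V →ₗ[B] W) hs

end Covers

section Weights

variable {k : Type*} {L : Type u} [CommRing k] [Field L] [Algebra k L]

/-- The span of the vectors on which the right action is a twist of the left action. -/
def weightSpan (M : CentralBimodule.{u} k L L) : Submodule k M :=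
  Submodule.span k {x | ∃ φ : L ≃ₐ[k] L, ∀ b, M.right b x = M.left (φ b) x}

lemma left_mem_weightSpan (M : CentralBimodule.{u} k L L) (a : L) {x : M}
    (hx : x ∈ M.weightSpan) : M.left a x ∈ M.weightSpan := by
  have : M.weightSpan ≤ M.weightSpan.comap (M.left a) := by
    refine Submodule.span_le.2 ?_
    rintro x ⟨φ, hφ⟩
    refine Submodule.subset_span ⟨φ, fun b ↦ ?_⟩
    rw [← M.left_right, hφ, ← Module.End.mul_apply, ← Module.End.mul_apply, ← map_mul, ← map_mul,
      mul_comm]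
  exact this hx

lemma Covers.weightSpan_eq_top {M N : CentralBimodule.{u} k L L} (h : M.Covers N)
    (hM : M.weightSpan = ⊤) : N.weightSpan = ⊤ := by
  obtain ⟨f, hf, hs⟩ := h
  have : M.weightSpan ≤ N.weightSpan.comap f := by
    refine Submodule.span_le.2 ?_
    rintro x ⟨φ, hφ⟩
    exact Submodule.subset_span ⟨φ, fun b ↦ by rw [← hf.2, hφ, hf.1]⟩
  refine eq_top_iff.2 fun y _ ↦ ?_
  obtain ⟨x, rfl⟩ := hs y
  exact this (by rw [hM]; trivial)

lemma tensor_weightSpan {M N : CentralBimodule.{u} k L L} (hM : M.weightSpan = ⊤)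
    (hN : N.weightSpan = ⊤) : (M.tensor N).weightSpan = ⊤ := by
  refine (Submodule.eq_top_iff').2 fun y ↦ ?_
  induction y using tensor_induction with
  | zero => exact zero_mem _
  | add y z hy hz => exact add_mem hy hz
  | tmul x y =>
    have hx : x ∈ M.weightSpan := by rw [hM]; trivial
    have hy : y ∈ N.weightSpan := by rw [hN]; trivial
    induction hx using Submodule.span_induction generalizing y with
    | zero => rw [← tmulₗ_apply, map_zero]; exact zero_mem _
    | add x x' _ _ h h' => rw [add_tmul]; exact add_mem (h _ hy) (h' _ hy)
    | smul c x _ h => rw [smul_tmul]; exact Submodule.smul_mem _ _ (h _ hy)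
    | mem x hx =>
      obtain ⟨φ, hφ⟩ := hx
      induction hy using Submodule.span_induction with
      | zero => rw [← tmulₗ_apply, map_zero]; exact zero_mem _
      | add x x' _ _ h h' => rw [tmul_add]; exact add_mem h h'
      | smul c x _ h => rw [tmul_smul]; exact Submodule.smul_mem _ _ h
      | mem y hy =>
        obtain ⟨ψ, hψ⟩ := hy
        refine Submodule.subset_span ⟨ψ.trans φ, fun b ↦ ?_⟩
        rw [right_tmul, hψ, ← tmul_balanced, hφ, left_tmul]
        rfl

lemma weightSpan_ofHom (φ : L ≃ₐ[k] L) : (ofHom (φ : L →ₐ[k] L)).weightSpan = ⊤ :=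
  eq_top_iff.2 fun _ _ ↦ Submodule.subset_span ⟨φ, fun _ ↦ rfl⟩

lemma weightSpan_of_isomorphic {M : CentralBimodule.{u} k L L} {n : ℕ} (φ : Fin n → L ≃ₐ[k] L)
    (h : M.Isomorphic (directSum fun i ↦ ofHom (φ i : L →ₐ[k] L))) : M.weightSpan = ⊤ := by
  refine h.symm.covers.weightSpan_eq_top (eq_top_iff.2 fun (x : Fin n → L) _ ↦ ?_)
  have hx : x = ∑ i, Pi.single i (x i) := (Finset.univ_sum_single x).symm
  rw [hx]
  refine Submodule.sum_mem _ fun i _ ↦ Submodule.subset_span ⟨φ i, fun b ↦ ?_⟩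
  refine funext fun j ↦ ?_
  change φ j b * (Pi.single i (x i) : Fin n → L) j = φ i b * (Pi.single i (x i) : Fin n → L) j
  rcases eq_or_ne j i with rfl | hj
  · rfl
  · rw [Pi.single_eq_of_ne hj, mul_zero, mul_zero]

lemma isomorphic_of_weightSpan {M : CentralBimodule.{u} k L L} (hf : M.LeftFinite)
    (h : M.weightSpan = ⊤) : ∃ (n : ℕ) (φ : Fin n → L ≃ₐ[k] L),
      M.Isomorphic (directSum fun i ↦ ofHom (φ i : L →ₐ[k] L)) := by
  let := M.leftModule
  have : Module.Finite L M := hf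
  let S : Set M := {x | ∃ φ : L ≃ₐ[k] L, ∀ b, M.right b x = M.left (φ b) x}
  have hS : ⊤ ≤ Submodule.span L S := by
    intro x _
    have hx : x ∈ M.weightSpan := by rw [h]; trivial
    induction hx using Submodule.span_induction with
    | mem x hx => exact Submodule.subset_span hx
    | zero => exact zero_mem _
    | add x y _ _ hx hy => exact add_mem (hx trivial) (hy trivial)
    | smul c x _ hx =>
      rw [← left_algebraMap]
      exact Submodule.smul_mem _ (algebraMap k L c) (hx trivial)
  let b₀ := Module.Basis.ofSpan hS
  have hb₀ : ∀ i, b₀ i ∈ S := fun i ↦ Module.Basis.ofSpan_subset hS ⟨i, rfl⟩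
  have := Module.Finite.finite_basis b₀
  have := Fintype.ofFinite ((linearIndepOn_empty L id).extend (Set.empty_subset S))
  let b := b₀.reindex (Fintype.equivFin _)
  have hb : ∀ i, b i ∈ S := fun i ↦ by rw [Module.Basis.reindex_apply]; exact hb₀ _
  choose φ hφ using hb
  refine ⟨_, φ, Isomorphic.symm ⟨?_, ?_, ?_⟩⟩
  · exact { b.equivFun.symm with
      map_smul' := fun c x ↦ by
        rw [RingHom.id_apply, ← left_algebraMap, ← left_algebraMap]
        exact b.equivFun.symm.map_smul (algebraMap k L c) x }
  · exact fun a x ↦ b.equivFun.symm.map_smul a x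
  · intro a (x : Fin _ → L)
    change b.equivFun.symm (fun i ↦ φ i a * (x i : L)) = M.right a (b.equivFun.symm x)
    rw [Module.Basis.equivFun_symm_apply, Module.Basis.equivFun_symm_apply, map_sum]
    refine Finset.sum_congr rfl fun i _ ↦ ?_
    change M.left (φ i a * x i) (b i) = M.right a (M.left (x i) (b i))
    rw [← M.left_right, hφ, mul_comm, map_mul]
    rfl

end Weights

section Balanced

variable {k : Type*} {K : Type u} (L : Type u) [Field k] [Field K] [Field L] [Algebra k K]
  [Algebra k L] [Algebra K L] [IsScalarTower k K L]

variable (k K) in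
/-- `L` as an `L`-`K`-bimodule. -/
def fieldLeft : CentralBimodule.{u} k L K := ofHom (IsScalarTower.toAlgHom k K L)

variable (k K) in
/-- `L` as a `K`-`L`-bimodule. -/
def fieldRight : CentralBimodule.{u} k K L :=
  (ofHom (AlgHom.id k L)).restrict (IsScalarTower.toAlgHom k K L) (AlgHom.id k L)

/-- The `L`-bimodule `L ⊗_K V ⊗_K L`. -/
def extendScalars (V : CentralBimodule.{u} k K K) : CentralBimodule.{u} k L L :=
  ((fieldLeft k K L).tensor V).tensor (fieldRight k K L)

/-- A `K`-bimodule `V` is `L`-balanced if `L ⊗_K V ⊗_K L` is a (finite) direct sum of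
`L`-bimodules `L_φ` with `φ ∈ Aut L`. -/
def IsBalanced (V : CentralBimodule.{u} k K K) : Prop :=
  ∃ (n : ℕ) (φ : Fin n → L ≃ₐ[k] L),
    (V.extendScalars L).Isomorphic (directSum fun i ↦ ofHom (φ i : L →ₐ[k] L))

variable {L}

lemma IsBalanced.weightSpan {V : CentralBimodule.{u} k K K} (h : V.IsBalanced L) :
    (V.extendScalars L).weightSpan = ⊤ := by
  obtain ⟨n, φ, h⟩ := h
  exact weightSpan_of_isomorphic φ h

lemma fieldLeft_leftFinite : (fieldLeft k K L).LeftFinite := ofHom_leftFinite _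

lemma fieldRight_rightFinite : (fieldRight k K L).RightFinite :=
  ofHom_leftFinite (AlgHom.id k L)

lemma fieldRight_leftFinite [FiniteDimensional K L] : (fieldRight k K L).LeftFinite := by
  have h : (fieldRight k K L).leftModule = (inferInstance : Module K L) :=
    Module.ext' _ _ fun a (x : L) ↦ (Algebra.smul_def a x).symm
  unfold LeftFinite
  rw [h]
  exact (inferInstance : Module.Finite K L)

lemma fieldLeft_rightFinite [FiniteDimensional K L] : (fieldLeft k K L).RightFinite :=
  fieldRight_leftFinite (k := k) (K := K) (L := L)

lemma isBalanced_of_weightSpan [FiniteDimensional K L] {V : CentralBimodule.{u} k K K}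
    (hf : V.LeftFinite) (h : (V.extendScalars L).weightSpan = ⊤) : V.IsBalanced L :=
  isomorphic_of_weightSpan ((fieldLeft_leftFinite.tensor hf).tensor fieldRight_leftFinite) h

lemma trace_covers [FiniteDimensional K L] [IsGalois K L] :
    ((fieldRight k K L).tensor (fieldLeft k K L)).Covers (ofHom (AlgHom.id k K)) := by
  let β : L →ₗ[k] L →ₗ[k] K :=
    (LinearMap.mul k L).compr₂ ((Algebra.trace K L).restrictScalars k)
  let f : (fieldRight k K L).tensor (fieldLeft k K L) →ₗ[k] ofHom (AlgHom.id k K) :=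
    tensorLift (V := fieldRight k K L) (W := fieldLeft k K L) β
      (fun (v : L) (b : L) (w : L) ↦ by
        change Algebra.trace K L (b * v * w) = Algebra.trace K L (v * (b * w))
        congr 1; ring)
  refine ⟨f, ⟨fun (a : K) ↦ LinearMap.congr_fun (f := f ∘ₗ _)
    (g := (ofHom (AlgHom.id k K)).left a ∘ₗ f) (tensor_hom_ext fun (v : L) (w : L) ↦ ?_),
    fun (a : K) ↦ LinearMap.congr_fun (f := f ∘ₗ _)
    (g := (ofHom (AlgHom.id k K)).right a ∘ₗ f) (tensor_hom_ext fun (v : L) (w : L) ↦ ?_)⟩,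
    fun (a : K) ↦ ?_⟩
  · change Algebra.trace K L (algebraMap K L a * v * w) = a * Algebra.trace K L (v * w)
    rw [mul_assoc, ← Algebra.smul_def, map_smul, smul_eq_mul]
  · change Algebra.trace K L (v * (algebraMap K L a * w)) = a * Algebra.trace K L (v * w)
    rw [mul_left_comm, ← Algebra.smul_def, map_smul, smul_eq_mul]
  · obtain ⟨x, hx⟩ := Algebra.trace_surjective K L a
    refine ⟨tmul (V := fieldRight k K L) (W := fieldLeft k K L) x (1 : L), ?_⟩
    change Algebra.trace K L (x * 1) = a
    rw [mul_one, hx]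

lemma weightSpan_field [FiniteDimensional K L] [IsGalois K L] :
    ((fieldLeft k K L).tensor (fieldRight k K L)).weightSpan = ⊤ := by
  classical
  let M := (fieldLeft k K L).tensor (fieldRight k K L)
  let t : L →ₗ[k] L →ₗ[k] M := tmulₗ (fieldLeft k K L) (fieldRight k K L)
  have hb : ∀ (a : K) x y, t (a • x) y = t x (a • y) := fun a x y ↦ by
    rw [Algebra.smul_def, Algebra.smul_def]
    exact tmul_balanced (V := fieldLeft k K L) (W := fieldRight k K L) x a y
  have hl : ∀ a x y, M.left a (t x y) = t (a * x) y := fun _ _ _ ↦ rfl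
  have hr : ∀ a x y, M.right a (t x y) = t x (a * y) := fun _ _ _ ↦ rfl
  let x := Module.finBasis K L
  let y := x.traceDual
  have hx : ∀ z, z = ∑ i, Algebra.trace K L (z * y i) • x i := fun z ↦ by
    have := y.traceDual.sum_repr z
    simp only [Module.Basis.traceDual_repr_apply, Algebra.traceForm_apply] at this
    rw [show y.traceDual = x from x.traceDual_traceDual] at this
    exact this.symm
  have hy : ∀ z, z = ∑ i, Algebra.trace K L (z * x i) • y i := fun z ↦ by
    have := y.sum_repr z
    simp only [y, Module.Basis.traceDual_repr_apply, Algebra.traceForm_apply] at this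
    exact this.symm
  have casimir : ∀ b : L, ∑ i, t (b * x i) (y i) = ∑ i, t (x i) (b * y i) := fun b ↦ by
    calc ∑ i, t (b * x i) (y i)
        = ∑ i, ∑ j, t (x j) (Algebra.trace K L (b * x i * y j) • y i) := by
          refine Finset.sum_congr rfl fun i _ ↦ ?_
          conv_lhs => rw [hx (b * x i), map_sum, LinearMap.sum_apply]
          exact Finset.sum_congr rfl fun j _ ↦ hb _ _ _
      _ = ∑ j, t (x j) (b * y j) := by
          rw [Finset.sum_comm]
          refine Finset.sum_congr rfl fun j _ ↦ ?_
          conv_rhs => rw [hy (b * y j), map_sum]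
          exact Finset.sum_congr rfl fun i _ ↦ by rw [mul_right_comm]
  have htw : ∀ (σ : L ≃ₐ[K] L) (b : L), ∑ i, t (σ b * x i) (σ.symm (y i)) =
      ∑ i, t (x i) (b * σ.symm (y i)) := fun σ b ↦ by
    let T : M →ₗ[k] M := tensorLift (V := fieldLeft k K L) (W := fieldRight k K L)
      (t.compl₁₂ LinearMap.id (σ.symm.toLinearMap.restrictScalars k))
      (fun (v : L) (a : K) (w : L) ↦ by
        change t (algebraMap K L a * v) (σ.symm w) = t v (σ.symm (algebraMap K L a * w))
        rw [← Algebra.smul_def, ← Algebra.smul_def, map_smul σ.symm, hb])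
    have hT : ∀ u v, T (t u v) = t u (σ.symm v) := fun _ _ ↦ rfl
    have := congrArg T (casimir (σ b))
    rw [map_sum, map_sum] at this
    simpa only [hT, map_mul, AlgEquiv.symm_apply_apply] using this
  let e : (L ≃ₐ[K] L) → M := fun σ ↦ ∑ i, t (x i) (σ.symm (y i))
  have he : ∀ σ b, M.right b (e σ) = M.left (σ b) (e σ) := fun σ b ↦ by
    simp only [e, map_sum, hl, hr, htw]
  have hmem : ∀ σ, e σ ∈ M.weightSpan := fun σ ↦
    Submodule.subset_span ⟨σ.restrictScalars k, he σ⟩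
  have hone : ∑ σ, e σ = t 1 1 := by
    simp only [e]
    rw [Finset.sum_comm]
    simp_rw [← map_sum]
    have : ∀ i, ∑ σ : L ≃ₐ[K] L, σ.symm (y i) = algebraMap K L (Algebra.trace K L (y i)) := by
      intro i
      rw [trace_eq_sum_automorphisms]
      exact Fintype.sum_equiv (Equiv.inv (L ≃ₐ[K] L)) _ _ fun σ ↦ rfl
    simp_rw [this, Algebra.algebraMap_eq_smul_one, ← hb]
    have h1 := congrArg (fun z ↦ t z 1) (hx 1)
    simp only [map_sum, LinearMap.sum_apply, one_mul] at h1
    exact h1.symm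
  refine Submodule.eq_top_iff'.2 fun z ↦ ?_
  induction z using tensor_induction with
  | zero => exact zero_mem _
  | add z w hz hw => exact add_mem hz hw
  | tmul a b =>
    have key : ∀ a b : L, t a b ∈ M.weightSpan := fun a b ↦ by
      have : t a b = M.left a (M.right b (t 1 1)) := by rw [hr, hl, mul_one, mul_one]
      rw [this, ← hone, map_sum, map_sum]
      refine Submodule.sum_mem _ fun σ _ ↦ ?_
      rw [he]
      exact left_mem_weightSpan _ _ (left_mem_weightSpan _ _ (hmem σ))
    exact key a b

lemma isBalanced_unit [FiniteDimensional K L] [IsGalois K L] :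
    (ofHom (AlgHom.id k K)).IsBalanced L :=
  isBalanced_of_weightSpan (ofHom_leftFinite _)
    (((tensor_unit _).symm.covers.tensor_right _).weightSpan_eq_top weightSpan_field)

lemma IsBalanced.tensor [FiniteDimensional K L] [IsGalois K L] {V W : CentralBimodule.{u} k K K}
    (hV : V.IsBalanced L) (hW : W.IsBalanced L) (hV' : V.LeftFinite) (hW' : W.LeftFinite) :
    (V.tensor W).IsBalanced L := by
  refine isBalanced_of_weightSpan (hV'.tensor hW')
    (Covers.weightSpan_eq_top ?_ (tensor_weightSpan hV.weightSpan hW.weightSpan))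
  let S := fieldLeft k K L
  let T := fieldRight k K L
  have h1 : (T.tensor (W.extendScalars L)).Covers (W.tensor T) :=
    (tensor_assoc T (S.tensor W) T).symm.covers.trans
      ((((tensor_assoc T S W).symm.covers.trans (trace_covers.tensor_right W)).trans
        (unit_tensor W).covers).tensor_right T)
  exact (tensor_assoc (S.tensor V) T _).covers.trans ((h1.tensor_left (S.tensor V)).trans
    ((tensor_assoc (S.tensor V) W T).symm.covers.trans
      ((tensor_assoc S V W).covers.tensor_right T)))

variable (K) in
/-- The group `St(φι)` of all `g ∈ G(L/K)` with `g φ ι = φ ι`, for the inclusion `ι : K → L`. -/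
def stabilizer (φ : L ≃ₐ[k] L) : Subgroup (L ≃ₐ[K] L) where
  carrier := {g | ∀ x : K, g (φ (algebraMap K L x)) = φ (algebraMap K L x)}
  one_mem' := fun _ ↦ rfl
  mul_mem' := fun {g h} hg hh x ↦ by rw [AlgEquiv.mul_apply, hh x, hg x]
  inv_mem' := fun {g} hg x ↦ by
    rw [AlgEquiv.aut_inv, AlgEquiv.symm_apply_eq, hg x]

variable (K) in
/-- The embedding `K → L^H` induced by `φ`, for `H = St(φι)`. -/
def fixedEmbedding (φ : L ≃ₐ[k] L) : K →ₐ[k] IntermediateField.fixedField (stabilizer K φ) where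
  toFun x := ⟨φ (algebraMap K L x), fun g ↦ g.2 x⟩
  map_one' := Subtype.ext (by simp)
  map_mul' x y := Subtype.ext (by simp)
  map_zero' := Subtype.ext (by simp)
  map_add' x y := Subtype.ext (by simp)
  commutes' c := Subtype.ext (by
    change φ (algebraMap K L (algebraMap k K c)) = algebraMap k L c
    rw [← IsScalarTower.algebraMap_apply, AlgEquiv.commutes])

variable (K) in
/-- The `K`-bimodule `V(φ) = (L_φ)^H` for `H = St(φι)`: its underlying space is `L^H`, and
`a · x · b = a x φ(b)` for `a, b ∈ K`. -/
def simpleBimodule (φ : L ≃ₐ[k] L) : CentralBimodule.{u} k K K :=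
  (ofHom (fixedEmbedding K φ)).restrict
    (IsScalarTower.toAlgHom k K (IntermediateField.fixedField (stabilizer K φ))) (AlgHom.id k K)

lemma covers_simpleBimodule [FiniteDimensional K L] [IsGalois K L] (φ : L ≃ₐ[k] L) :
    ((fieldRight k K L).tensor ((ofHom (φ : L →ₐ[k] L)).tensor (fieldLeft k K L))).Covers
      (simpleBimodule K φ) := by
  let E := IntermediateField.fixedField (stabilizer K φ)
  have : IsScalarTower k E L := .of_algebraMap_eq fun _ ↦ rfl
  let tr : L →ₗ[k] E := (Algebra.trace E L).restrictScalars k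
  let p : L →ₗ[k] L →ₗ[k] E := (LinearMap.mul k L).compr₂ tr
  let m : L →ₗ[k] L →ₗ[k] L := (LinearMap.mul k L).compl₂ φ.toLinearMap
  let f₀ : (ofHom (φ : L →ₐ[k] L)).tensor (fieldLeft k K L) →ₗ[k] L →ₗ[k] E :=
    tensorLift (V := ofHom (φ : L →ₐ[k] L)) (W := fieldLeft k K L) (m.compr₂ p)
      (fun (v b w : L) ↦ by
        change p (φ b * v * φ w) = p (v * φ (b * w))
        rw [map_mul φ]
        congr 1; ring)
  have hf₀ : ∀ v b : L, f₀.flip (b * v) =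
      f₀.flip v ∘ₗ ((ofHom (φ : L →ₐ[k] L)).tensor (fieldLeft k K L)).left b := fun v b ↦ by
    refine tensor_hom_ext fun (x y : L) ↦ ?_
    change tr (x * φ y * (b * v)) = tr (b * x * φ y * v)
    congr 1; ring
  let f : (fieldRight k K L).tensor ((ofHom (φ : L →ₐ[k] L)).tensor (fieldLeft k K L)) →ₗ[k]
      simpleBimodule K φ :=
    tensorLift (V := fieldRight k K L) f₀.flip (fun v b y ↦ LinearMap.congr_fun (hf₀ v b) y)
  refine ⟨f, ⟨fun a ↦ LinearMap.congr_fun (f := f ∘ₗ _)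
    (g := (simpleBimodule K φ).left a ∘ₗ f) (tensor_hom_ext_right fun (v x y : L) ↦ ?_),
    fun a ↦ LinearMap.congr_fun (f := f ∘ₗ _)
    (g := (simpleBimodule K φ).right a ∘ₗ f) (tensor_hom_ext_right fun (v x y : L) ↦ ?_)⟩,
    fun (a : E) ↦ ?_⟩
  · change Algebra.trace E L (x * φ y * (algebraMap K L a * v)) =
      algebraMap K E a * Algebra.trace E L (x * φ y * v)
    rw [mul_left_comm]
    exact (Algebra.trace E L).map_smul (algebraMap K E a) (x * φ y * v)
  · change Algebra.trace E L (x * φ (algebraMap K L a * y) * v) =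
      fixedEmbedding K φ a * Algebra.trace E L (x * φ y * v)
    rw [map_mul φ, mul_left_comm, mul_assoc]
    exact (Algebra.trace E L).map_smul (fixedEmbedding K φ a) (x * φ y * v)
  · obtain ⟨x, hx⟩ := Algebra.trace_surjective E L a
    refine ⟨tmul (V := fieldRight k K L) (1 : L)
      (tmul (V := ofHom (φ : L →ₐ[k] L)) (W := fieldLeft k K L) x (1 : L)), ?_⟩
    change Algebra.trace E L (x * φ 1 * 1) = a
    rw [map_one, mul_one, mul_one, hx]

lemma ofHom_rightFinite (φ : L ≃ₐ[k] L) : (ofHom (φ : L →ₐ[k] L)).RightFinite :=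
  (rightFinite_iff _).2 ⟨({(1 : L)} : Finset L), fun (v : L) ↦
    AddSubgroup.subset_closure ⟨φ.symm v, (1 : L), Finset.mem_singleton_self _, by
      change v = φ (φ.symm v) * 1
      rw [mul_one, φ.apply_symm_apply]⟩⟩

lemma simpleBimodule_leftFinite [FiniteDimensional K L] [IsGalois K L] (φ : L ≃ₐ[k] L) :
    (simpleBimodule K φ).LeftFinite :=
  (covers_simpleBimodule φ).leftFinite
    (fieldRight_leftFinite.tensor ((ofHom_leftFinite _).tensor fieldLeft_leftFinite))

lemma simpleBimodule_rightFinite [FiniteDimensional K L] [IsGalois K L] (φ : L ≃ₐ[k] L) :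
    (simpleBimodule K φ).RightFinite :=
  (covers_simpleBimodule φ).rightFinite
    (fieldRight_rightFinite.tensor ((ofHom_rightFinite φ).tensor fieldLeft_rightFinite))

lemma simpleBimodule_isBalanced [FiniteDimensional K L] [IsGalois K L] (φ : L ≃ₐ[k] L) :
    (simpleBimodule K φ).IsBalanced L := by
  let S := fieldLeft k K L
  let T := fieldRight k K L
  let X := ofHom (φ : L →ₐ[k] L)
  have h : ((S.tensor T).tensor (X.tensor (S.tensor T))).Covers
      ((simpleBimodule K φ).extendScalars L) :=
    ((tensor_assoc X S T).symm.covers.tensor_left (S.tensor T)).trans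
      ((tensor_assoc (S.tensor T) (X.tensor S) T).symm.covers.trans
        (((tensor_assoc S T (X.tensor S)).covers.trans
          ((covers_simpleBimodule φ).tensor_left S)).tensor_right T))
  exact isBalanced_of_weightSpan (simpleBimodule_leftFinite φ) (h.weightSpan_eq_top
    (tensor_weightSpan weightSpan_field (tensor_weightSpan (weightSpan_ofHom φ) weightSpan_field)))

end Balanced

end CentralBimodule

open CentralBimodule

section Grothendieck

/-- The objects of the category `K-bimod_L`: the `L`-balanced `k`-central `K`-bimodules which are
finite dimensional from both sides. -/
structure BalancedBimodule (k : Type*) (K L : Type u) [Field k] [Field K] [Field L] [Algebra k K]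
    [Algebra k L] [Algebra K L] [IsScalarTower k K L] where
  toBimodule : CentralBimodule.{u} k K K
  leftFinite : toBimodule.LeftFinite
  rightFinite : toBimodule.RightFinite
  isBalanced : toBimodule.IsBalanced L

variable (k : Type*) (K L : Type u) [Field k] [Field K] [Field L] [Algebra k K]
  [Algebra k L] [Algebra K L] [IsScalarTower k K L]

/-- The relations `[V] = [U] + [W]` for all short exact sequences `0 → U → V → W → 0`. -/
def grothendieckRel : AddSubgroup (FreeAbelianGroup (BalancedBimodule k K L)) :=
  AddSubgroup.closure {x | ∃ U V W : BalancedBimodule k K L,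
    ShortExact U.toBimodule V.toBimodule W.toBimodule ∧
      x = FreeAbelianGroup.of V - FreeAbelianGroup.of U - FreeAbelianGroup.of W}

/-- The Grothendieck group `K₀(K, L)` of the category of `L`-balanced `K`-bimodules. -/
def GrothendieckRing : Type _ :=
  FreeAbelianGroup (BalancedBimodule k K L) ⧸ grothendieckRel k K L

instance : AddCommGroup (GrothendieckRing k K L) :=
  inferInstanceAs (AddCommGroup (FreeAbelianGroup (BalancedBimodule k K L) ⧸ grothendieckRel k K L))

variable {k K L}

/-- The class `[V]` in the Grothendieck group. -/
def BalancedBimodule.cls (V : BalancedBimodule k K L) : GrothendieckRing k K L :=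
  QuotientAddGroup.mk (FreeAbelianGroup.of V)

/-- The unit object `K`. -/
def BalancedBimodule.unit [FiniteDimensional K L] [IsGalois K L] : BalancedBimodule k K L where
  toBimodule := ofHom (AlgHom.id k K)
  leftFinite := ofHom_leftFinite _
  rightFinite := ofHom_leftFinite (AlgHom.id k K)
  isBalanced := isBalanced_unit

/-- The tensor product `V ⊗_K W`. -/
def BalancedBimodule.tensor [FiniteDimensional K L] [IsGalois K L]
    (V W : BalancedBimodule k K L) : BalancedBimodule k K L where
  toBimodule := V.toBimodule.tensor W.toBimodule
  leftFinite := V.leftFinite.tensor W.leftFinite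
  rightFinite := V.rightFinite.tensor W.rightFinite
  isBalanced := V.isBalanced.tensor W.isBalanced V.leftFinite W.leftFinite

/-- The simple object `V(φ)`, for `φ ∈ Aut L`. -/
def BalancedBimodule.simple [FiniteDimensional K L] [IsGalois K L] (φ : L ≃ₐ[k] L) :
    BalancedBimodule k K L where
  toBimodule := simpleBimodule K φ
  leftFinite := simpleBimodule_leftFinite φ
  rightFinite := simpleBimodule_rightFinite φ
  isBalanced := simpleBimodule_isBalanced φ

lemma cls_eq_add {U V W : BalancedBimodule k K L}
    (h : ShortExact U.toBimodule V.toBimodule W.toBimodule) : V.cls = U.cls + W.cls := by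
  have : FreeAbelianGroup.of V - FreeAbelianGroup.of U - FreeAbelianGroup.of W ∈
      grothendieckRel k K L := AddSubgroup.subset_closure ⟨U, V, W, h, rfl⟩
  have h0 := (QuotientAddGroup.eq_zero_iff _).2 this
  refine sub_eq_zero.1 ?_
  rw [← sub_sub]
  exact h0

lemma shortExact_of_isomorphic {U V W : CentralBimodule.{u} k K K} (hU : Subsingleton U)
    (h : V.Isomorphic W) : ShortExact U V W := by
  obtain ⟨e, he⟩ := h
  refine ⟨0, e.toLinearMap, ⟨fun _ _ ↦ ?_, fun _ _ ↦ ?_⟩, he,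
    Function.injective_of_subsingleton _, fun x ↦ ?_, e.surjective⟩
  · simp
  · simp
  · constructor
    · intro hx
      exact ⟨0, by rw [map_zero]; exact (e.map_eq_zero_iff.1 hx).symm⟩
    · rintro ⟨y, rfl⟩
      simp

/-- The zero object. -/
lemma exists_zero : ∃ Z : BalancedBimodule k K L, Subsingleton Z.toBimodule := by
  let Z : CentralBimodule.{u} k K K := directSum (n := 0) fun i ↦ i.elim0
  have hZ : Subsingleton Z := ⟨fun x y ↦ funext fun i ↦ i.elim0⟩
  have hE : Subsingleton (Z.extendScalars L) := by
    refine subsingleton_of_forall_eq 0 fun x ↦ ?_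
    induction x using tensor_induction with
    | zero => rfl
    | add x y hx hy => exact (congrArg₂ (· + ·) hx hy).trans (add_zero _)
    | tmul y z =>
      have : y = 0 := by
        induction y using tensor_induction with
        | zero => rfl
        | add x y hx hy => rw [hx, hy, add_zero]
        | tmul a b => rw [Subsingleton.elim b 0, ← tmulₗ_apply, map_zero]
      rw [this, ← tmulₗ_apply, map_zero]
      rfl
  refine ⟨⟨Z, (leftFinite_iff _).2 ⟨∅, fun v ↦ ?_⟩, (rightFinite_iff _).2 ⟨∅, fun v ↦ ?_⟩,
    0, fun i ↦ i.elim0, Isomorphic.of_inverse 0 0 ?_ ?_ ?_ ?_⟩, hZ⟩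
  · rw [Subsingleton.elim v 0]; exact zero_mem _
  · rw [Subsingleton.elim v 0]; exact zero_mem _
  · exact LinearMap.ext fun x ↦ funext fun i ↦ i.elim0
  · exact LinearMap.ext fun x ↦ Subsingleton.elim _ _
  · exact fun a ↦ LinearMap.ext fun x ↦ funext fun i ↦ i.elim0
  · exact fun a ↦ LinearMap.ext fun x ↦ funext fun i ↦ i.elim0

lemma cls_eq {V W : BalancedBimodule k K L} (h : V.toBimodule.Isomorphic W.toBimodule) :
    V.cls = W.cls := by
  obtain ⟨Z, hZ⟩ := exists_zero (k := k) (K := K) (L := L)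
  have hi : Z.toBimodule.Isomorphic Z.toBimodule :=
    ⟨LinearEquiv.refl k _, fun _ _ ↦ rfl, fun _ _ ↦ rfl⟩
  have h0 := cls_eq_add (shortExact_of_isomorphic hZ hi)
  rw [cls_eq_add (shortExact_of_isomorphic hZ h), left_eq_add.1 h0, zero_add]

lemma cls_induction {p : GrothendieckRing k K L → Prop} (x : GrothendieckRing k K L)
    (zero : p 0) (cls : ∀ V : BalancedBimodule k K L, p V.cls) (neg : ∀ x, p x → p (-x))
    (add : ∀ x y, p x → p y → p (x + y)) : p x := by
  obtain ⟨x, rfl⟩ := QuotientAddGroup.mk_surjective x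
  induction x using FreeAbelianGroup.induction_on with
  | zero => exact zero
  | of V => exact cls V
  | neg V h => exact neg _ h
  | add x y hx hy => exact add _ _ hx hy

lemma cls_hom_ext {M : Type*} [AddCommGroup M] {f g : GrothendieckRing k K L →+ M}
    (h : ∀ V : BalancedBimodule k K L, f V.cls = g V.cls) : f = g := by
  ext x
  refine cls_induction (p := fun x ↦ f x = g x) x (by simp) h (fun x hx ↦ ?_)
    fun x y hx hy ↦ ?_
  · rw [map_neg, map_neg, hx]
  · rw [map_add, map_add, hx, hy]

/-- The homomorphism out of the Grothendieck group given by an additive function. -/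
def clsLift {M : Type*} [AddCommGroup M] (f : BalancedBimodule k K L → M)
    (hf : ∀ U V W : BalancedBimodule k K L,
      ShortExact U.toBimodule V.toBimodule W.toBimodule → f V = f U + f W) :
    GrothendieckRing k K L →+ M :=
  QuotientAddGroup.lift _ (FreeAbelianGroup.lift f) (by
    refine (AddSubgroup.closure_le _).2 ?_
    rintro _ ⟨U, V, W, h, rfl⟩
    change FreeAbelianGroup.lift f _ = 0
    rw [map_sub, map_sub, FreeAbelianGroup.lift_apply_of, FreeAbelianGroup.lift_apply_of,
      FreeAbelianGroup.lift_apply_of, hf U V W h]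
    abel)

@[simp] lemma clsLift_cls {M : Type*} [AddCommGroup M] (f : BalancedBimodule k K L → M)
    (hf : ∀ U V W : BalancedBimodule k K L,
      ShortExact U.toBimodule V.toBimodule W.toBimodule → f V = f U + f W)
    (V : BalancedBimodule k K L) : clsLift f hf V.cls = f V :=
  FreeAbelianGroup.lift_apply_of f V

variable [FiniteDimensional K L] [IsGalois K L]

/-- The multiplication of the Grothendieck ring, with `[V] [W] = [V ⊗_K W]`. -/
def clsMul : GrothendieckRing k K L →+ GrothendieckRing k K L →+ GrothendieckRing k K L :=
  clsLift (fun V ↦ clsLift (fun W ↦ (V.tensor W).cls)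
      fun _ _ _ h ↦ cls_eq_add (h.tensor_left V.toBimodule))
    fun _ _ _ h ↦ cls_hom_ext fun X ↦ cls_eq_add (h.tensor_right X.toBimodule)

instance : Mul (GrothendieckRing k K L) := ⟨fun x y ↦ clsMul x y⟩

instance : One (GrothendieckRing k K L) := ⟨BalancedBimodule.unit.cls⟩

lemma cls_mul (V W : BalancedBimodule k K L) : V.cls * W.cls = (V.tensor W).cls := rfl

lemma cls_mul_assoc (x y z : GrothendieckRing k K L) : x * y * z = x * (y * z) := by
  change clsMul (clsMul x y) z = clsMul x (clsMul y z)
  refine cls_induction (p := fun x ↦ clsMul (clsMul x y) z = clsMul x (clsMul y z)) x (by simp)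
    (fun U ↦ ?_) (fun x hx ↦ ?_) fun x x' hx hx' ↦ ?_
  · refine cls_induction (p := fun y ↦ clsMul (clsMul U.cls y) z = clsMul U.cls (clsMul y z)) y
      (by simp) (fun V ↦ ?_) (fun y hy ↦ ?_) fun y y' hy hy' ↦ ?_
    · have : clsMul (clsMul U.cls V.cls) = (clsMul U.cls).comp (clsMul V.cls) :=
        cls_hom_ext fun W ↦ cls_eq (tensor_assoc U.toBimodule V.toBimodule W.toBimodule)
      exact DFunLike.congr_fun this z
    · simp only [map_neg, AddMonoidHom.neg_apply, hy]
    · simp only [map_add, AddMonoidHom.add_apply, hy, hy']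
  · simp only [map_neg, AddMonoidHom.neg_apply, hx]
  · simp only [map_add, AddMonoidHom.add_apply, hx, hx']

lemma cls_one_mul (x : GrothendieckRing k K L) : 1 * x = x := by
  have : clsMul (BalancedBimodule.unit.cls) = AddMonoidHom.id (GrothendieckRing k K L) :=
    cls_hom_ext fun V ↦ cls_eq (unit_tensor V.toBimodule)
  exact DFunLike.congr_fun this x

lemma cls_mul_one (x : GrothendieckRing k K L) : x * 1 = x := by
  have : clsMul.flip (BalancedBimodule.unit.cls) = AddMonoidHom.id (GrothendieckRing k K L) :=
    cls_hom_ext fun V ↦ cls_eq (tensor_unit V.toBimodule)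
  exact DFunLike.congr_fun this x

/-- The ring structure on `K₀(K, L)`, with `[V] [W] = [V ⊗_K W]` and `1 = [K]`. -/
instance : Ring (GrothendieckRing k K L) :=
  { (inferInstance : AddCommGroup (GrothendieckRing k K L)),
    (inferInstance : Mul (GrothendieckRing k K L)),
    (inferInstance : One (GrothendieckRing k K L)) with
    left_distrib := fun x y z ↦ map_add (clsMul x) y z
    right_distrib := fun x y z ↦ DFunLike.congr_fun (map_add clsMul x y) z
    zero_mul := fun x ↦ DFunLike.congr_fun (map_zero clsMul) x
    mul_zero := fun x ↦ map_zero (clsMul x)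
    mul_assoc := cls_mul_assoc
    one_mul := cls_one_mul
    mul_one := cls_mul_one }

end Grothendieck

section Hecke

variable {Ω : Type*} [Group Ω]

/-- The element `∑_{x ∈ s} x` of the group algebra `ℚ[Ω]`. -/
def setSum (s : Set Ω) (hs : s.Finite) : MonoidAlgebra ℚ Ω :=
  ∑ x ∈ hs.toFinset, MonoidAlgebra.single x 1

variable (G : Subgroup Ω) [Finite G]

lemma finite_doubleCoset (φ : Ω) : (DoubleCoset.doubleCoset φ (G : Set Ω) G).Finite := by
  rw [DoubleCoset.doubleCoset_eq_image2]
  exact Set.Finite.image2 _ (Set.toFinite _) (Set.toFinite _)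

/-- `b_φ = ∑_{ψ ∈ GφG} ψ`. -/
def doubleCosetSum (φ : Ω) : MonoidAlgebra ℚ Ω :=
  setSum (DoubleCoset.doubleCoset φ (G : Set Ω) G) (finite_doubleCoset G φ)

/-- `e_G = (1/|G|) ∑_{g ∈ G} g`. -/
def heckeIdempotent : MonoidAlgebra ℚ Ω :=
  (1 / Nat.card G : ℚ) • setSum (G : Set Ω) (Set.toFinite _)

lemma heckeIdempotent_isIdempotentElem : IsIdempotentElem (heckeIdempotent G) := by
  have h : ∀ g ∈ G, MonoidAlgebra.single g (1 : ℚ) * setSum (G : Set Ω) (Set.toFinite _) =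
      setSum (G : Set Ω) (Set.toFinite _) := by
    intro g hg
    rw [setSum, Finset.mul_sum]
    refine Finset.sum_bij' (fun x _ ↦ g * x) (fun x _ ↦ g⁻¹ * x) ?_ ?_ ?_ ?_ ?_
    · intro x hx
      simpa [G.mul_mem_cancel_left hg] using hx
    · intro x hx
      simpa [G.mul_mem_cancel_left (G.inv_mem hg)] using hx
    · simp
    · simp
    · simp [MonoidAlgebra.single_mul_single]
  have hs : setSum (G : Set Ω) (Set.toFinite _) * setSum (G : Set Ω) (Set.toFinite _) =
      (Nat.card G : ℚ) • setSum (G : Set Ω) (Set.toFinite _) := by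
    conv_lhs => enter [1]; rw [setSum]
    rw [Finset.sum_mul, Finset.sum_congr rfl (fun g hg ↦ h g (by simpa using hg)),
      Finset.sum_const, ← Nat.cast_smul_eq_nsmul ℚ]
    congr 2
    exact (Nat.card_eq_card_finite_toFinset _).symm
  have h0 : (Nat.card G : ℚ) ≠ 0 := Nat.cast_ne_zero.2 Nat.card_pos.ne'
  rw [IsIdempotentElem, heckeIdempotent, smul_mul_smul_comm, hs, smul_smul]
  congr 1
  field_simp

/-- The Hecke algebra `H_ℚ(Ω; G) = e_G ℚ[Ω] e_G`, a ring with identity `e_G`. -/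
abbrev HeckeAlgebra : Type _ := (heckeIdempotent_isIdempotentElem G).Corner

instance : SMul ℚ (HeckeAlgebra G) :=
  ⟨fun c x ↦ ⟨c • x.1, by
    obtain ⟨y, hy⟩ := x.2
    exact ⟨c • y, by rw [← hy]; simp⟩⟩⟩

instance : Module ℚ (HeckeAlgebra G) :=
  Function.Injective.module ℚ
    (⟨⟨fun x ↦ x.1, rfl⟩, fun _ _ ↦ rfl⟩ : HeckeAlgebra G →+ MonoidAlgebra ℚ Ω)
    Subtype.val_injective fun _ _ ↦ rfl

instance : Algebra ℚ (HeckeAlgebra G) :=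
  Algebra.ofModule (fun c x y ↦ Subtype.ext (smul_mul_assoc c x.1 y.1))
    fun c x y ↦ Subtype.ext (mul_smul_comm c x.1 y.1)

end Hecke

/-- The Galois group `G(L/K)` as a subgroup of `Aut L`, the group of `k`-automorphisms of `L`. -/
def galoisSubgroup (k : Type*) (K L : Type u) [Field k] [Field K] [Field L] [Algebra k K]
    [Algebra k L] [Algebra K L] [IsScalarTower k K L] : Subgroup (L ≃ₐ[k] L) :=
  (AlgEquiv.restrictScalarsHom k : (L ≃ₐ[K] L) →* (L ≃ₐ[k] L)).range

instance (k : Type*) (K L : Type u) [Field k] [Field K] [Field L] [Algebra k K]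
    [Algebra k L] [Algebra K L] [IsScalarTower k K L] [FiniteDimensional K L] :
    Finite (galoisSubgroup k K L) :=
  Finite.of_surjective _
    (MonoidHom.rangeRestrict_surjective
      (AlgEquiv.restrictScalarsHom k : (L ≃ₐ[K] L) →* (L ≃ₐ[k] L)))

end

/-! Both algebras are represented faithfully on the `ℚ`-vector space `K`, with the same image. Write
`n = [L : K]` and `e = e_G`.

A bimodule `V` acts on `K` by sending `b` to the trace of right multiplication by `b` on the left
`K`-space `V`. This is additive on short exact sequences (`leftTrace_of_shortExact`), and tensor
products become compositions (`leftTrace_tensor`), so it gives a representation `traceAlgHom` of the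
rational Grothendieck ring. On the other side, `ℚ[Aut L]` acts on `L`, faithfully by Dedekind's
independence of automorphisms (`autAction_injective`). The idempotent `e` acts as the projection
`(1/n) Tr` onto `K`, so an element of the Hecke algebra is determined by its compression to `K`
(`eq_zero_of_compressedAction_eq_zero`), and on the Hecke algebra compression is multiplicative.

The link is the bimodule `L_φ` viewed over `K` (`twist`). Its trace function is `b ↦ Tr(φ b)`, which
is `n` times the compression of `φ`. Its class depends only on `GφG`, so the map `φ ↦ (1/n)[L_φ]` is
unchanged by `x ↦ e x e` and is determined by its restriction to the Hecke algebra. It is onto,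
because the restriction to `K` of `L ⊗ V ⊗ L` has class `n²[V]` and, `V` being balanced, is a sum of
twists (`exists_finrank_sq_mul_cls`). Followed by the trace representation it becomes compression,
which is injective. Hence it is bijective, the trace representation is faithful, and compatibility
with products and units can be checked in `End_ℚ(K)`.

The normalisation comes from two occurrences of `H`: `[L_φ] = |H| [V(φ)]`, by transitivity of the
trace through `L^H`, and `e φ e = (|H|/n²) b_φ`, by counting. So `[V(φ)]` corresponds to `(n/|H|) e
φ e = (1/n) b_φ`. Uniqueness holds because the classes `[V(φ)]` span rationally. -/

noncomputable section

open CentralBimodule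

namespace CentralBimodule

/-! ### Trace functions of bimodules: additivity on exact sequences. -/

section Trace

variable {k : Type*} {K B C : Type*} [CommRing k] [Field K] [CommRing B] [CommRing C]
  [Algebra k K] [Algebra k B] [Algebra k C]

/-- The right multiplication by `b`, as an endomorphism of the underlying left vector space. -/
def rightEnd (V : CentralBimodule.{u} k K B) (b : B) : letI := V.leftModule; V →ₗ[K] V :=
  letI := V.leftModule
  { V.right b with map_smul' := fun a v ↦ (V.left_right a b v).symm }

/-- The trace of the right multiplications on the underlying left vector space. -/
def leftTrace (V : CentralBimodule.{u} k K B) : B →+ K :=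
  letI := V.leftModule
  { toFun := fun b ↦ LinearMap.trace K V (V.rightEnd b)
    map_zero' := by
      rw [show V.rightEnd 0 = 0 from LinearMap.ext fun v ↦ LinearMap.congr_fun (map_zero V.right) v,
        map_zero]
    map_add' := fun b c ↦ by
      rw [show V.rightEnd (b + c) = V.rightEnd b + V.rightEnd c from
        LinearMap.ext fun v ↦ LinearMap.congr_fun (map_add V.right b c) v, map_add] }

/-- The sequence splits over the left field, and in such a splitting the right action is block
triangular, so its trace is the sum of the traces of the diagonal blocks. -/
lemma leftTrace_of_shortExact {U V W : CentralBimodule.{u} k K B} (h : ShortExact U V W)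
    (hU : U.LeftFinite) (hV : V.LeftFinite) (hW : W.LeftFinite) :
    V.leftTrace = U.leftTrace + W.leftTrace := by
  obtain ⟨f, g, hf, hg, hi, he, hs⟩ := h
  -- The splitting lemma is about right actions; exchanging the sides makes `p` and `s` linear for
  -- the left action of `K`.
  obtain ⟨p, s, hp, hs', hpf, hgs, hfs⟩ := exists_right_splitting (U := U.swap) (V := V.swap)
    (W := W.swap) (f := f) (g := g) ⟨hf.2, hf.1⟩ ⟨hg.2, hg.1⟩ hi he hs
  let := U.leftModule
  let := V.leftModule
  let := W.leftModule
  have : Module.Finite K U := hU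
  have : Module.Finite K V := hV
  have : Module.Finite K W := hW
  let f' : U →ₗ[K] V := { f with map_smul' := hf.1 }
  let g' : V →ₗ[K] W := { g with map_smul' := hg.1 }
  let p' : V →ₗ[K] U := { p with map_smul' := hp }
  let s' : W →ₗ[K] V := { s with map_smul' := hs' }
  ext b
  change LinearMap.trace K V (V.rightEnd b) =
    LinearMap.trace K U (U.rightEnd b) + LinearMap.trace K W (W.rightEnd b)
  -- Each summand factors through `U` or `W`, so cyclicity of the trace moves it to an endomorphism
  -- of that space.
  have h1 : V.rightEnd b = f' ∘ₗ (p' ∘ₗ V.rightEnd b) + (s' ∘ₗ W.rightEnd b) ∘ₗ g' :=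
    LinearMap.ext fun v ↦ by
      change V.right b v = f' (p' (V.right b v)) + s' (W.right b (g v))
      rw [← hg.2]
      exact (hfs _).symm
  have h2 : (p' ∘ₗ V.rightEnd b) ∘ₗ f' = U.rightEnd b := LinearMap.ext fun u ↦ by
    change p (V.right b (f u)) = U.right b u
    rw [← hf.2]; exact hpf _
  have h3 : g' ∘ₗ (s' ∘ₗ W.rightEnd b) = W.rightEnd b := LinearMap.ext fun w ↦ hgs _
  rw [h1, map_add, LinearMap.trace_comp_comm' _ f', LinearMap.trace_comp_comm' g', h2, h3]

end Trace

/-! ### Trace functions of tensor products. -/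

section TraceTensor

variable {k : Type*} {K F C : Type*} [CommRing k] [Field K] [Field F] [CommRing C]
  [Algebra k K] [Algebra k F] [Algebra k C]

/-- An `F`-basis `n` of `W` decomposes `V ⊗ W` into copies `V ⊗ n j` of `V`. The diagonal block of
right multiplication by `c` at `j` is right multiplication on `V` by the diagonal matrix entry of
`c` on `W`; summing over `j` applies the trace function of `V` to the trace on `W`. This is what
makes the trace a ring representation. -/
lemma leftTrace_tensor {V : CentralBimodule.{u} k K F} {W : CentralBimodule.{u} k F C}
    (hV : V.LeftFinite) (hW : W.LeftFinite) :
    (V.tensor W).leftTrace = V.leftTrace.comp W.leftTrace := by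
  classical
  let := V.leftModule
  let := W.leftModule
  let := (V.tensor W).leftModule
  have : Module.Finite K V := hV
  have : Module.Finite F W := hW
  have : Module.Finite K (V.tensor W) := hV.tensor hW
  let n := Module.finBasis F W
  -- `α j` and `β j` are the inclusion of and the projection to the copy of `V` indexed by `j`.
  let α : Fin (Module.finrank F W) → V →ₗ[K] V.tensor W := fun j ↦
    { toFun := fun v ↦ tmul v (n j)
      map_add' := fun v v' ↦ add_tmul v v' _
      map_smul' := fun _ _ ↦ rfl }
  let β₀ : Fin (Module.finrank F W) → V.tensor W →ₗ[k] V := fun j ↦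
    tensorLift (LinearMap.mk₂ k (fun v w ↦ V.right (n.coord j w) v)
      (fun v v' w ↦ map_add _ _ _) (fun c v w ↦ map_smul _ _ _)
      (fun v w w' ↦ by rw [map_add, map_add, LinearMap.add_apply])
      (fun c v w ↦ by
        rw [← left_algebraMap]
        have : n.coord j (W.left (algebraMap k F c) w) = algebraMap k F c * n.coord j w :=
          (n.coord j).map_smul (algebraMap k F c) w
        rw [this, map_mul, Module.End.mul_apply, right_algebraMap]))
      (fun v b w ↦ by
        have : n.coord j (W.left b w) = b * n.coord j w := (n.coord j).map_smul b w
        simp only [LinearMap.mk₂_apply]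
        rw [this, mul_comm, map_mul, Module.End.mul_apply])
  have hβ₀ : ∀ j v w, β₀ j (tmul v w) = V.right (n.coord j w) v := fun _ _ _ ↦ rfl
  let β : Fin (Module.finrank F W) → V.tensor W →ₗ[K] V := fun j ↦
    { β₀ j with
      map_smul' := fun a x ↦ LinearMap.congr_fun (f := β₀ j ∘ₗ (V.tensor W).left a)
        (g := V.left a ∘ₗ β₀ j) (tensor_hom_ext fun v w ↦ (V.left_right _ _ _).symm) x }
  have hβ : ∀ j v w, β j (tmul v w) = V.right (n.coord j w) v := fun _ _ _ ↦ rfl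
  have hsum : ∀ x, ∑ j, α j (β j x) = x := fun x ↦ by
    induction x using tensor_induction with
    | zero => simp
    | add x y hx hy => simp only [map_add, Finset.sum_add_distrib, hx, hy]
    | tmul v w =>
      change ∑ j, tmul (V.right (n.coord j w) v) (n j) = tmul v w
      simp only [tmul_balanced]
      have := congrArg (tmulₗ V W v) (n.sum_repr w)
      rw [map_sum] at this
      exact this
  ext c
  change LinearMap.trace K _ ((V.tensor W).rightEnd c) =
    V.leftTrace (LinearMap.trace F W (W.rightEnd c))
  -- Inserting `∑ j, α j ∘ β j = id` lets cyclicity of the trace isolate the diagonal blocks `β j ∘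
  -- c ∘ α j`.
  have h1 : (V.tensor W).rightEnd c =
      ∑ j, ((V.tensor W).rightEnd c ∘ₗ α j) ∘ₗ β j := LinearMap.ext fun x ↦ by
    rw [LinearMap.sum_apply]
    conv_lhs => rw [← hsum x, map_sum]
    rfl
  rw [h1, map_sum, LinearMap.trace_eq_matrix_trace F n, Matrix.trace, map_sum]
  refine Finset.sum_congr rfl fun j _ ↦ ?_
  rw [LinearMap.trace_comp_comm']
  change _ = LinearMap.trace K V (V.rightEnd _)
  congr 1
  refine LinearMap.ext fun v ↦ ?_
  change V.right (n.coord j (W.right c (n j))) v = _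
  rw [Matrix.diag_apply, LinearMap.toMatrix_apply]
  rfl

end TraceTensor

/-! ### Trace functions of bimodules that are fields. -/

section TraceField

variable {k : Type*} {K L : Type u} [CommRing k] [Field K] [Field L] [Algebra k K] [Algebra k L]
  [Algebra K L] [IsScalarTower k K L]

/-- The left module structure of a bimodule on `L` agrees with the algebra structure only
propositionally; keeping it as a variable `m` allows it to be substituted. -/
lemma trace_eq_of_forall_mul (m : Module K L) (hm : m = Algebra.toModule)
    (T : letI := m; L →ₗ[K] L) (c : L) (hT : ∀ x, T x = c * x) :
    (letI := m; LinearMap.trace K L T) = Algebra.trace K L c := by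
  subst hm
  rw [Algebra.trace_apply]
  congr 1
  exact LinearMap.ext hT

lemma leftTrace_restrict_ofHom {B C : Type*} [CommRing B] [CommRing C] [Algebra k B] [Algebra k C]
    (φ : B →ₐ[k] L) (ψ : C →ₐ[k] B) (c : C) :
    ((ofHom φ).restrict (IsScalarTower.toAlgHom k K L) ψ).leftTrace c =
      Algebra.trace K L (φ (ψ c)) :=
  trace_eq_of_forall_mul _ (Module.ext' _ _ fun a (x : L) ↦ (Algebra.smul_def a x).symm) _ _
    fun _ ↦ rfl

end TraceField

end CentralBimodule

namespace CentralBimodule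

/-! ### Composition, restriction and tensoring of bimodule maps. -/

section Functoriality

variable {k A B C D : Type*} [CommRing k] [CommRing A] [CommRing B] [CommRing C] [CommRing D]
  [Algebra k A] [Algebra k B] [Algebra k C] [Algebra k D]

lemma Isomorphic.trans {U V W : CentralBimodule.{u} k A B} (h : U.Isomorphic V)
    (h' : V.Isomorphic W) : U.Isomorphic W := by
  obtain ⟨e, he⟩ := h
  obtain ⟨f, hf⟩ := h'
  exact ⟨e.trans f, hf.comp he⟩

lemma Isomorphic.restrict {V W : CentralBimodule.{u} k B C} (h : V.Isomorphic W) (α : A →ₐ[k] B)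
    (β : D →ₐ[k] C) : (V.restrict α β).Isomorphic (W.restrict α β) := by
  obtain ⟨e, he⟩ := h
  exact ⟨e, fun a ↦ he.1 (α a), fun d ↦ he.2 (β d)⟩

lemma isHom_tensorMap_id {V W : CentralBimodule.{u} k B C} {f : V →ₗ[k] W} (hf : IsHom f)
    (X : CentralBimodule.{u} k A B) : IsHom (V := X.tensor V) (W := X.tensor W)
      (tensorMap (LinearMap.id : X →ₗ[k] X) f (fun _ _ ↦ rfl) hf.1) := by
  refine ⟨fun a v ↦ ?_, fun a v ↦ ?_⟩
  · induction v using tensor_induction with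
    | zero => simp only [map_zero]
    | tmul v x => rfl
    | add x y hx hy => rw [map_add, map_add, map_add, map_add, hx, hy]
  · induction v using tensor_induction with
    | zero => simp only [map_zero]
    | tmul x v => exact congrArg (tmul x) (hf.2 a v)
    | add x y hx hy => rw [map_add, map_add, map_add, map_add, hx, hy]

end Functoriality

/-! ### Finite direct sums of bimodules. -/

section DirectSum

variable {k A B : Type*} [CommRing k] [CommRing A] [CommRing B] [Algebra k A] [Algebra k B]
  {n : ℕ}

/-- The inclusion of a summand. -/
def directSumSingle (V : Fin n → CentralBimodule.{u} k A B) (i : Fin n) :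
    V i →ₗ[k] directSum V :=
  LinearMap.single k (fun i ↦ V i) i

/-- The projection to a summand. -/
def directSumProj (V : Fin n → CentralBimodule.{u} k A B) (i : Fin n) :
    directSum V →ₗ[k] V i :=
  LinearMap.proj i

lemma isHom_directSumSingle (V : Fin n → CentralBimodule.{u} k A B) (i : Fin n) :
    IsHom (directSumSingle V i) := by
  refine ⟨fun a v ↦ funext fun j ↦ ?_, fun a v ↦ funext fun j ↦ ?_⟩
  · change Pi.single (M := fun i ↦ V i) i ((V i).left a v) j =
      (V j).left a (Pi.single (M := fun i ↦ V i) i v j)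
    rcases eq_or_ne j i with rfl | hj
    · rw [Pi.single_eq_same, Pi.single_eq_same]
    · rw [Pi.single_eq_of_ne hj, Pi.single_eq_of_ne hj, map_zero]
  · change Pi.single (M := fun i ↦ V i) i ((V i).right a v) j =
      (V j).right a (Pi.single (M := fun i ↦ V i) i v j)
    rcases eq_or_ne j i with rfl | hj
    · rw [Pi.single_eq_same, Pi.single_eq_same]
    · rw [Pi.single_eq_of_ne hj, Pi.single_eq_of_ne hj, map_zero]

lemma isHom_directSumProj (V : Fin n → CentralBimodule.{u} k A B) (i : Fin n) :
    IsHom (directSumProj V i) :=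
  ⟨fun _ _ ↦ rfl, fun _ _ ↦ rfl⟩

lemma sum_directSumSingle_proj (V : Fin n → CentralBimodule.{u} k A B) (x : directSum V) :
    ∑ i, directSumSingle V i (directSumProj V i x) = x :=
  Finset.univ_sum_single (M := fun i ↦ V i) x

lemma directSum_leftFinite {V : Fin n → CentralBimodule.{u} k A B} (h : ∀ i, (V i).LeftFinite) :
    (directSum V).LeftFinite := by
  let := fun i ↦ (V i).leftModule
  let := (directSum V).leftModule
  have : ∀ i, Module.Finite A (V i) := h
  exact Module.Finite.of_surjective (M := ∀ i, V i) (P := directSum V) (σ := RingHom.id _)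
    { toFun := fun x ↦ x, map_add' := fun _ _ ↦ rfl, map_smul' := fun _ _ ↦ rfl } fun x ↦ ⟨x, rfl⟩

lemma directSum_rightFinite {V : Fin n → CentralBimodule.{u} k A B}
    (h : ∀ i, (V i).RightFinite) : (directSum V).RightFinite := by
  let := fun i ↦ (V i).rightModule
  let := (directSum V).rightModule
  have : ∀ i, Module.Finite B (V i) := h
  exact Module.Finite.of_surjective (M := ∀ i, V i) (P := directSum V) (σ := RingHom.id _)
    { toFun := fun x ↦ x, map_add' := fun _ _ ↦ rfl, map_smul' := fun _ _ ↦ rfl } fun x ↦ ⟨x, rfl⟩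

/-- Splitting off the first summand is the induction step for computing the class of a direct sum.
-/
lemma shortExact_directSum (V : Fin (n + 1) → CentralBimodule.{u} k A B) :
    ShortExact (V 0) (directSum V) (directSum fun i ↦ V i.succ) := by
  let g : directSum V →ₗ[k] directSum fun i ↦ V i.succ :=
    LinearMap.pi (φ := fun i : Fin n ↦ V i.succ) fun i ↦ directSumProj V i.succ
  refine ⟨directSumSingle V 0, g, isHom_directSumSingle V 0, ⟨fun _ _ ↦ rfl, fun _ _ ↦ rfl⟩,
    Pi.single_injective (M := fun i ↦ V i) 0, fun x ↦ ⟨fun hx ↦ ⟨directSumProj V 0 x, ?_⟩, ?_⟩,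
    fun y ↦ ⟨Fin.cons (α := fun i ↦ V i) 0 y, rfl⟩⟩
  · refine funext fun j ↦ ?_
    change Pi.single (M := fun i ↦ V i) 0 (x 0) j = x j
    induction j using Fin.cases with
    | zero => rw [Pi.single_eq_same]
    | succ j =>
      rw [Pi.single_eq_of_ne (Fin.succ_ne_zero j)]
      exact (congrFun hx j).symm
  · rintro ⟨y, rfl⟩
    exact funext fun j ↦ Pi.single_eq_of_ne (M := fun i ↦ V i) (Fin.succ_ne_zero j) y

end DirectSum

/-! ### Weight vectors under bimodule maps. -/

section WeightSpan

variable {k : Type*} {L : Type u} [CommRing k] [Field L] [Algebra k L]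

lemma IsHom.map_mem_weightSpan {M N : CentralBimodule.{u} k L L} {f : M →ₗ[k] N} (hf : IsHom f)
    {x : M} (hx : x ∈ M.weightSpan) : f x ∈ N.weightSpan := by
  have : M.weightSpan ≤ N.weightSpan.comap f := by
    refine Submodule.span_le.2 ?_
    rintro x ⟨φ, hφ⟩
    exact Submodule.subset_span ⟨φ, fun b ↦ by rw [← hf.2, hφ, hf.1]⟩
  exact this hx

end WeightSpan

/-! ### The bimodules `L_φ` over `K`, and balancedness. -/

section Balanced

variable {k : Type*} {K L : Type u} [Field k] [Field K] [Field L] [Algebra k K]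
  [Algebra k L] [Algebra K L] [IsScalarTower k K L]

variable (K) in
/-- The `K`-bimodule underlying `L_φ`. -/
def twist (φ : L ≃ₐ[k] L) : CentralBimodule.{u} k K K :=
  (ofHom (φ : L →ₐ[k] L)).restrict (IsScalarTower.toAlgHom k K L) (IsScalarTower.toAlgHom k K L)

/-- The two unit isomorphisms for `L`, with the outer actions restricted to `K`. Finiteness and
balancedness of the twist are read off from this factorisation. -/
lemma tensor_twist (φ : L ≃ₐ[k] L) :
    ((fieldRight k K L).tensor ((ofHom (φ : L →ₐ[k] L)).tensor (fieldLeft k K L))).Isomorphic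
      (twist K φ) := by
  have h1 : ((ofHom (φ : L →ₐ[k] L)).tensor (fieldLeft k K L)).Isomorphic
      ((ofHom (φ : L →ₐ[k] L)).restrict (AlgHom.id k L) (IsScalarTower.toAlgHom k K L)) := by
    obtain ⟨e, he⟩ := tensor_unit (ofHom (φ : L →ₐ[k] L))
    exact ⟨e, he.1, fun d ↦ he.2 (algebraMap K L d)⟩
  obtain ⟨e, he⟩ := (unit_tensor _).trans h1
  exact ⟨e, fun a ↦ he.1 (algebraMap K L a), he.2⟩

/-- The isomorphism is `x ↦ g x`, while `h` is invisible because only elements of `K` act on the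
right. Hence the class of a twist depends only on the double coset of `φ`. -/
lemma twist_comp_galois (φ : L ≃ₐ[k] L) (g h : L ≃ₐ[K] L) :
    (twist K φ).Isomorphic (twist K (g.restrictScalars k * φ * h.restrictScalars k)) := by
  refine ⟨(g.restrictScalars k).toLinearEquiv, fun (a : K) (x : L) ↦ ?_, fun (a : K) (x : L) ↦ ?_⟩
  · change g (algebraMap K L a * x) = algebraMap K L a * g x
    rw [map_mul, g.commutes]
  · change g (φ (algebraMap K L a) * x) = g (φ (h (algebraMap K L a))) * g x
    rw [map_mul, h.commutes]

/-- Extending scalars to `L` and restricting back to `K` is tensoring on both sides with the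
`K`-bimodule `L`, with the same underlying space; this turns the operation into multiplication by
classes. -/
lemma restrict_extendScalars (V : CentralBimodule.{u} k K K) :
    (((twist K (1 : L ≃ₐ[k] L)).tensor V).tensor (twist K (1 : L ≃ₐ[k] L))).Isomorphic
      ((V.extendScalars L).restrict (IsScalarTower.toAlgHom k K L)
        (IsScalarTower.toAlgHom k K L)) :=
  ⟨LinearEquiv.refl k _, fun _ _ ↦ rfl, fun _ _ ↦ rfl⟩

variable [FiniteDimensional K L]

/-- The scalar extension of the sum is spanned by the images of the scalar extensions of the
summands, and bimodule maps preserve spans of weight vectors. -/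
lemma isBalanced_directSum {n : ℕ} {V : Fin n → CentralBimodule.{u} k K K}
    (hf : ∀ i, (V i).LeftFinite) (h : ∀ i, (V i).IsBalanced L) : (directSum V).IsBalanced L := by
  refine isBalanced_of_weightSpan (directSum_leftFinite hf) (Submodule.eq_top_iff'.2 fun x ↦ ?_)
  let S := fieldLeft k K L
  let T := fieldRight k K L
  let f := fun i ↦ tensorMap (tensorMap (LinearMap.id : S →ₗ[k] S) (directSumSingle V i)
    (fun _ _ ↦ rfl) (isHom_directSumSingle V i).1) (LinearMap.id : T →ₗ[k] T)
    (isHom_tensorMap_id (isHom_directSumSingle V i) S).2 fun _ _ ↦ rfl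
  let p := fun i ↦ tensorMap (tensorMap (LinearMap.id : S →ₗ[k] S) (directSumProj V i)
    (fun _ _ ↦ rfl) (isHom_directSumProj V i).1) (LinearMap.id : T →ₗ[k] T)
    (isHom_tensorMap_id (isHom_directSumProj V i) S).2 fun _ _ ↦ rfl
  have hf : ∀ i, IsHom (V := (V i).extendScalars L) (W := (directSum V).extendScalars L) (f i) :=
    fun i ↦ isHom_tensorMap (isHom_tensorMap_id (isHom_directSumSingle V i) S) T
  -- Tensoring is additive, so the decomposition of the identity of the direct sum survives scalar
  -- extension.
  have key : ∑ i, f i ∘ₗ p i = LinearMap.id := tensor_hom_ext_left fun a v b ↦ by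
    have h1 := congrArg (fun w ↦ (tmulₗ (S.tensor (directSum V)) T).flip b
      (tmulₗ S (directSum V) a w)) (sum_directSumSingle_proj V v)
    simp only [map_sum] at h1
    rw [LinearMap.sum_apply]
    exact h1
  have hx : x = ∑ i, f i (p i x) := by
    exact (LinearMap.congr_fun key x).symm.trans (LinearMap.sum_apply _ _ _)
  rw [hx]
  refine Submodule.sum_mem _ fun i _ ↦ (hf i).map_mem_weightSpan ?_
  rw [(h i).weightSpan]
  trivial

lemma twist_leftFinite (φ : L ≃ₐ[k] L) : (twist K φ).LeftFinite :=
  (tensor_twist φ).covers.leftFinite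
    (fieldRight_leftFinite.tensor ((ofHom_leftFinite _).tensor fieldLeft_leftFinite))

lemma twist_rightFinite (φ : L ≃ₐ[k] L) : (twist K φ).RightFinite :=
  (tensor_twist φ).covers.rightFinite
    (fieldRight_rightFinite.tensor ((ofHom_rightFinite φ).tensor fieldLeft_rightFinite))

/-- The scalar extension is a quotient of `(L ⊗_K L) ⊗_L L_φ ⊗_L (L ⊗_K L)`. All three factors are
spanned by weight vectors, and this passes to tensor products and quotients. -/
lemma twist_isBalanced [IsGalois K L] (φ : L ≃ₐ[k] L) : (twist K φ).IsBalanced L := by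
  let S := fieldLeft k K L
  let T := fieldRight k K L
  let X := ofHom (φ : L →ₐ[k] L)
  have h : ((S.tensor T).tensor (X.tensor (S.tensor T))).Covers ((twist K φ).extendScalars L) :=
    ((tensor_assoc X S T).symm.covers.tensor_left (S.tensor T)).trans
      ((tensor_assoc (S.tensor T) (X.tensor S) T).symm.covers.trans
        (((tensor_assoc S T (X.tensor S)).covers.trans
          ((tensor_twist φ).covers.tensor_left S)).tensor_right T))
  exact isBalanced_of_weightSpan (twist_leftFinite φ) (h.weightSpan_eq_top
    (tensor_weightSpan weightSpan_field (tensor_weightSpan (weightSpan_ofHom φ) weightSpan_field)))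

/-- For `φ = 1` the left and right actions of `K` on `L` coincide, so coordinates in a `K`-basis
respect both. -/
lemma twist_one_isomorphic : (twist K (1 : L ≃ₐ[k] L)).Isomorphic
    (directSum fun _ : Fin (Module.finrank K L) ↦ ofHom (AlgHom.id k K)) := by
  let e := (Module.finBasis K L).equivFun
  refine ⟨e.restrictScalars k, fun (a : K) (x : L) ↦ ?_, fun (a : K) (x : L) ↦ ?_⟩
  · change e (algebraMap K L a * x) = a • e x
    rw [← Algebra.smul_def, map_smul]
  · change e (algebraMap K L a * x) = a • e x
    rw [← Algebra.smul_def, map_smul]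

end Balanced

end CentralBimodule


/-! ### Relations between classes in the Grothendieck ring. -/

section Classes

variable {k : Type*} {K L : Type u} [Field k] [Field K] [Field L] [Algebra k K]
  [Algebra k L] [Algebra K L] [IsScalarTower k K L] [FiniteDimensional K L]

/-- The direct sum of finitely many balanced bimodules. -/
def BalancedBimodule.directSum {n : ℕ} (V : Fin n → BalancedBimodule k K L) :
    BalancedBimodule k K L where
  toBimodule := CentralBimodule.directSum fun i ↦ (V i).toBimodule
  leftFinite := directSum_leftFinite fun i ↦ (V i).leftFinite
  rightFinite := directSum_rightFinite fun i ↦ (V i).rightFinite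
  isBalanced := isBalanced_directSum (fun i ↦ (V i).leftFinite) fun i ↦ (V i).isBalanced

lemma cls_directSum {n : ℕ} (V : Fin n → BalancedBimodule k K L) :
    (BalancedBimodule.directSum V).cls = ∑ i, (V i).cls := by
  induction n with
  | zero =>
    have hs : Subsingleton (BalancedBimodule.directSum V).toBimodule :=
      ⟨fun x y ↦ funext fun i ↦ i.elim0⟩
    -- For a zero object `Z`, the exact sequence `0 → Z → Z → Z → 0` gives `[Z] = [Z] + [Z]`.
    have h := cls_eq_add (shortExact_of_isomorphic hs
      (⟨LinearEquiv.refl k _, fun _ _ ↦ rfl, fun _ _ ↦ rfl⟩ :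
        (BalancedBimodule.directSum V).toBimodule.Isomorphic
          (BalancedBimodule.directSum V).toBimodule))
    rw [Finset.univ_eq_empty, Finset.sum_empty]
    exact left_eq_add.1 h
  | succ n ih =>
    have h : (BalancedBimodule.directSum V).cls =
        (V 0).cls + (BalancedBimodule.directSum fun i ↦ V i.succ).cls :=
      cls_eq_add (shortExact_directSum fun i ↦ (V i).toBimodule)
    rw [h, ih, Fin.sum_univ_succ]

variable [IsGalois K L]

/-- The `K`-bimodule underlying `L_φ`, as a balanced bimodule. -/
def BalancedBimodule.twist (φ : L ≃ₐ[k] L) : BalancedBimodule k K L where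
  toBimodule := CentralBimodule.twist K φ
  leftFinite := twist_leftFinite φ
  rightFinite := twist_rightFinite φ
  isBalanced := twist_isBalanced φ

lemma cls_twist_one : (BalancedBimodule.twist (K := K) (1 : L ≃ₐ[k] L)).cls =
    (Module.finrank K L : GrothendieckRing k K L) := by
  have h : (BalancedBimodule.twist (K := K) (1 : L ≃ₐ[k] L)).cls =
      (BalancedBimodule.directSum fun _ : Fin (Module.finrank K L) ↦
        (BalancedBimodule.unit : BalancedBimodule k K L)).cls := cls_eq twist_one_isomorphic
  rw [h, cls_directSum, Finset.sum_const, Finset.card_univ, Fintype.card_fin]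
  exact nsmul_one _

/-- The class `[L][V][L]` is computed in two ways: it is `[L : K]² [V]` because `[L] = [L : K]`, and
it is a sum of classes of twists because `L ⊗ V ⊗ L` is a sum of bimodules `L_φ`. Rationally, the
twists therefore span, and no classification of simple bimodules is needed. -/
lemma exists_finrank_sq_mul_cls (V : BalancedBimodule k K L) :
    ∃ (n : ℕ) (φ : Fin n → L ≃ₐ[k] L), (Module.finrank K L ^ 2) • V.cls =
      ∑ i, (BalancedBimodule.twist (K := K) (φ i)).cls := by
  obtain ⟨n, φ, h⟩ := V.isBalanced
  refine ⟨n, φ, ?_⟩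
  have h1 : (((BalancedBimodule.twist (K := K) (1 : L ≃ₐ[k] L)).tensor V).tensor
      (BalancedBimodule.twist (K := K) (1 : L ≃ₐ[k] L))).cls =
      (BalancedBimodule.directSum fun i ↦ BalancedBimodule.twist (K := K) (φ i)).cls := by
    refine cls_eq ((restrict_extendScalars V.toBimodule).trans ((h.restrict _ _).trans ?_))
    exact ⟨LinearEquiv.refl k _, fun _ _ ↦ rfl, fun _ _ ↦ rfl⟩
  -- The right factor `[L]` is an integer, hence central, and moves to the left of `V.cls`.
  rw [← cls_directSum, ← h1, ← cls_mul, ← cls_mul, cls_twist_one, nsmul_eq_mul,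
    mul_assoc, ← Nat.cast_comm, ← mul_assoc, Nat.cast_pow, sq]

lemma cls_twist_galois (φ : L ≃ₐ[k] L) (g h : L ≃ₐ[K] L) :
    (BalancedBimodule.twist (K := K) (g.restrictScalars k * φ * h.restrictScalars k)).cls =
      (BalancedBimodule.twist (K := K) φ).cls :=
  (cls_eq (twist_comp_galois φ g h)).symm

end Classes

/-! ### The faithful action of `ℚ[Aut L]` on `L`. -/

section Evaluation

variable {k L : Type*} [Field k] [Field L] [Algebra k L] [CharZero L]

variable (k L) in
/-- The action of the rational group algebra of `Aut L` on `L`. -/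
def autAction : MonoidAlgebra ℚ (L ≃ₐ[k] L) →ₐ[ℚ] Module.End ℚ L :=
  MonoidAlgebra.lift ℚ (Module.End ℚ L) (L ≃ₐ[k] L)
    { toFun := fun φ ↦ AddMonoidHom.toRatLinearMap (φ : L →+ L)
      map_one' := rfl
      map_mul' := fun _ _ ↦ rfl }

lemma autAction_single (φ : L ≃ₐ[k] L) (c : ℚ) (b : L) :
    autAction k L (MonoidAlgebra.single φ c) b = c • φ b := by
  rw [autAction, MonoidAlgebra.lift_single]
  rfl

/-- Dedekind: distinct automorphisms are linearly independent over `L` as functions on `L`, hence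
over `ℚ`. -/
lemma autAction_injective : Function.Injective (autAction k L) := by
  refine (injective_iff_map_eq_zero _).2 fun x hx ↦ ?_
  have hi : LinearIndependent ℚ fun (φ : L ≃ₐ[k] L) (b : L) ↦ φ b :=
    ((linearIndependent_monoidHom L L).comp (fun φ : L ≃ₐ[k] L ↦ ((φ : L →* L))) fun φ ψ h ↦
      AlgEquiv.ext fun b ↦ DFunLike.congr_fun h b).restrict_scalars' ℚ
  have : x.coeff = 0 := by
    refine linearIndependent_iff.1 hi _ (funext fun b ↦ ?_)
    have h := LinearMap.congr_fun hx b
    rw [autAction, MonoidAlgebra.lift_apply, Finsupp.sum, LinearMap.sum_apply] at h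
    rw [Finsupp.linearCombination_apply, Finsupp.sum, Finset.sum_apply]
    exact h
  exact MonoidAlgebra.coeff_injective this

end Evaluation

/-! ### Double cosets, the Hecke idempotent and compression to `K`. -/

section Galois

variable {k : Type*} {K L : Type u} [Field k] [Field K] [Field L] [Algebra k K]
  [Algebra k L] [Algebra K L] [IsScalarTower k K L] [FiniteDimensional K L]

lemma setSum_galoisSubgroup (h : (galoisSubgroup k K L : Set (L ≃ₐ[k] L)).Finite) :
    setSum (galoisSubgroup k K L : Set (L ≃ₐ[k] L)) h =
      ∑ σ : L ≃ₐ[K] L, MonoidAlgebra.single (σ.restrictScalars k) 1 := by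
  symm
  refine Finset.sum_bij (fun σ _ ↦ σ.restrictScalars k) (fun σ _ ↦ ?_) (fun σ _ τ _ h ↦ ?_)
    (fun φ hφ ↦ ?_) fun _ _ ↦ rfl
  · rw [Set.Finite.mem_toFinset]
    exact ⟨σ, rfl⟩
  · exact AlgEquiv.restrictScalarsHom_injective k h
  · rw [Set.Finite.mem_toFinset] at hφ
    obtain ⟨σ, rfl⟩ := hφ
    exact ⟨σ, Finset.mem_univ _, rfl⟩

/-- The fibres of `(σ, τ) ↦ σ φ τ` have as many elements as the stabilizer of `φ`. -/
lemma card_fiber_doubleCoset [DecidableEq (L ≃ₐ[k] L)] (φ : L ≃ₐ[k] L) (σ₀ τ₀ : L ≃ₐ[K] L) :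
    (Finset.univ.filter fun p : (L ≃ₐ[K] L) × (L ≃ₐ[K] L) ↦
      p.1.restrictScalars k * φ * p.2.restrictScalars k =
        σ₀.restrictScalars k * φ * τ₀.restrictScalars k).card = Nat.card (stabilizer K φ) := by
  classical
  rw [Nat.card_eq_fintype_card, ← Finset.card_univ]
  -- The equation `σ φ τ = σ₀ φ τ₀` is rewritten as `φ τ τ₀⁻¹ = σ⁻¹ σ₀ φ`.
  have key : ∀ p : (L ≃ₐ[K] L) × (L ≃ₐ[K] L), p.1.restrictScalars k * φ * p.2.restrictScalars k =
      σ₀.restrictScalars k * φ * τ₀.restrictScalars k → ∀ x, φ (p.2 (τ₀⁻¹ x)) = p.1⁻¹ (σ₀ (φ x)) := by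
    intro p hp x
    apply p.1.injective
    have h := DFunLike.congr_fun hp (τ₀⁻¹ x)
    change p.1 (φ (p.2 (τ₀⁻¹ x))) = σ₀ (φ (τ₀ (τ₀⁻¹ x))) at h
    rw [h, ← AlgEquiv.mul_apply τ₀, ← AlgEquiv.mul_apply p.1, mul_inv_cancel, mul_inv_cancel]
    rfl
  -- By `key`, `σ⁻¹ σ₀` fixes `φ(K)` pointwise, since `τ τ₀⁻¹` fixes `K`. It determines `σ`, and
  -- then `τ` by cancellation.
  refine Finset.card_bij (fun p hp ↦ ⟨p.1⁻¹ * σ₀, fun x ↦ ?_⟩) (fun _ _ ↦ Finset.mem_univ _)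
    (fun p hp q hq h ↦ ?_) fun η _ ↦ ?_
  · rw [AlgEquiv.mul_apply, ← key p (Finset.mem_filter.1 hp).2, AlgEquiv.commutes,
      AlgEquiv.commutes]
  · have h1 : p.1 = q.1 := by simpa using congrArg Subtype.val h
    have h2 := (Finset.mem_filter.1 hp).2.trans (Finset.mem_filter.1 hq).2.symm
    rw [h1, mul_right_inj] at h2
    exact Prod.ext h1 (AlgEquiv.restrictScalarsHom_injective k h2)
  -- The preimage of `η` is `(σ₀ η⁻¹, φ⁻¹ η φ τ₀)`; the conjugate `φ⁻¹ η φ` fixes `K` exactly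
  -- because `η` fixes `φ(K)`.
  · let ψ : L ≃ₐ[k] L := φ⁻¹ * (η : L ≃ₐ[K] L).restrictScalars k * φ
    let τ : L ≃ₐ[K] L := { ψ with
      commutes' := fun x ↦ by
        change φ.symm ((η : L ≃ₐ[K] L) (φ (algebraMap K L x))) = _
        rw [η.2 x, AlgEquiv.symm_apply_apply] }
    refine ⟨(σ₀ * (η : L ≃ₐ[K] L)⁻¹, τ * τ₀), Finset.mem_filter.2 ⟨Finset.mem_univ _, ?_⟩, ?_⟩
    · refine AlgEquiv.ext fun x ↦ ?_
      change σ₀ ((η : L ≃ₐ[K] L)⁻¹ (φ (φ.symm ((η : L ≃ₐ[K] L) (φ (τ₀ x)))))) = σ₀ (φ (τ₀ x))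
      rw [AlgEquiv.apply_symm_apply, AlgEquiv.aut_inv, AlgEquiv.symm_apply_apply]
    · exact Subtype.ext (by simp)

variable [IsGalois K L]

variable (k K L) in
lemma card_galoisSubgroup : Nat.card (galoisSubgroup k K L) = Module.finrank K L := by
  rw [← IsGalois.card_aut_eq_finrank]
  exact (Nat.card_congr (MonoidHom.ofInjective
    (AlgEquiv.restrictScalarsHom_injective (S := K) (A := L) k)).toEquiv).symm

lemma heckeIdempotent_galoisSubgroup : heckeIdempotent (galoisSubgroup k K L) =
    (1 / Module.finrank K L : ℚ) •
      ∑ σ : L ≃ₐ[K] L, MonoidAlgebra.single (σ.restrictScalars k) 1 := by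
  rw [heckeIdempotent, setSum_galoisSubgroup, card_galoisSubgroup]

/-- The products `σ φ τ` run over the double coset and hit each of its elements `|H|` times; the
denominator comes from the two idempotents. -/
lemma heckeIdempotent_mul_single_mul (φ : L ≃ₐ[k] L) :
    heckeIdempotent (galoisSubgroup k K L) * MonoidAlgebra.single φ 1 *
      heckeIdempotent (galoisSubgroup k K L) =
        ((Nat.card (stabilizer K φ) : ℚ) / (Module.finrank K L : ℚ) ^ 2) •
          doubleCosetSum (galoisSubgroup k K L) φ := by
  classical
  have h1 : (∑ σ : L ≃ₐ[K] L, MonoidAlgebra.single (σ.restrictScalars k) (1 : ℚ)) *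
      MonoidAlgebra.single φ 1 *
      (∑ σ : L ≃ₐ[K] L, MonoidAlgebra.single (σ.restrictScalars k) (1 : ℚ)) =
      ∑ p : (L ≃ₐ[K] L) × (L ≃ₐ[K] L),
        MonoidAlgebra.single (p.1.restrictScalars k * φ * p.2.restrictScalars k) (1 : ℚ) := by
    rw [Fintype.sum_prod_type, Finset.sum_mul, Finset.sum_mul_sum]
    simp only [MonoidAlgebra.single_mul_single, mul_one]
  have h2 : ∑ p : (L ≃ₐ[K] L) × (L ≃ₐ[K] L),
      MonoidAlgebra.single (p.1.restrictScalars k * φ * p.2.restrictScalars k) (1 : ℚ) =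
      (Nat.card (stabilizer K φ) : ℚ) • doubleCosetSum (galoisSubgroup k K L) φ := by
    rw [Finset.sum_comp (fun ψ ↦ MonoidAlgebra.single ψ (1 : ℚ))
      (fun p : (L ≃ₐ[K] L) × (L ≃ₐ[K] L) ↦ p.1.restrictScalars k * φ * p.2.restrictScalars k),
      doubleCosetSum, setSum, Finset.smul_sum]
    refine Finset.sum_congr ?_ fun ψ hψ ↦ ?_
    · ext ψ
      rw [Set.Finite.mem_toFinset, DoubleCoset.mem_doubleCoset, Finset.mem_image]
      constructor
      · rintro ⟨p, -, rfl⟩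
        exact ⟨_, ⟨p.1, rfl⟩, _, ⟨p.2, rfl⟩, rfl⟩
      · rintro ⟨_, ⟨σ, rfl⟩, _, ⟨τ, rfl⟩, rfl⟩
        exact ⟨(σ, τ), Finset.mem_univ _, rfl⟩
    · rw [Set.Finite.mem_toFinset, DoubleCoset.mem_doubleCoset] at hψ
      obtain ⟨_, ⟨σ, rfl⟩, _, ⟨τ, rfl⟩, rfl⟩ := hψ
      rw [Nat.cast_smul_eq_nsmul]
      congr 1
      exact card_fiber_doubleCoset φ σ τ
  rw [heckeIdempotent_galoisSubgroup, smul_mul_assoc, smul_mul_assoc, mul_smul_comm, h1, h2,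
    smul_smul, smul_smul]
  congr 1
  ring

variable [CharZero K] [CharZero L]

variable (K L) in
/-- The projection `(1 / [L : K]) Tr : L → K`. -/
def normalizedTrace : L →ₗ[ℚ] K :=
  (1 / Module.finrank K L : ℚ) •
    AddMonoidHom.toRatLinearMap (Algebra.trace K L).toAddMonoidHom

/-- The trace of a Galois extension is the sum of the conjugates, so `e_G` acts on `L` as the
projection onto `K`. -/
lemma algebraMap_normalizedTrace (b : L) : algebraMap K L (normalizedTrace K L b) =
    autAction k L (heckeIdempotent (galoisSubgroup k K L)) b := by
  have h : ∀ (c : ℚ) (x : K), algebraMap K L (c • x) = c • algebraMap K L x := fun c x ↦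
    map_rat_smul (algebraMap K L) c x
  rw [heckeIdempotent_galoisSubgroup, map_smul, map_sum, LinearMap.smul_apply,
    LinearMap.sum_apply, normalizedTrace, LinearMap.smul_apply, h]
  congr 1
  refine (trace_eq_sum_automorphisms b).trans (Finset.sum_congr rfl fun σ _ ↦ ?_)
  rw [autAction_single, one_smul]
  rfl

variable (k K L) in
/-- The compression to `K` of the action of the rational group algebra of `Aut L` on `L`. -/
def compressedAction : MonoidAlgebra ℚ (L ≃ₐ[k] L) →ₗ[ℚ] Module.End ℚ K where
  toFun x := normalizedTrace K L ∘ₗ autAction k L x ∘ₗ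
    AddMonoidHom.toRatLinearMap (algebraMap K L : K →+ L)
  map_add' x y := by rw [map_add, LinearMap.add_comp, LinearMap.comp_add]
  map_smul' c x := by rw [map_smul, LinearMap.smul_comp, LinearMap.comp_smul, RingHom.id_apply]

lemma algebraMap_compressedAction (x : MonoidAlgebra ℚ (L ≃ₐ[k] L)) (b : K) :
    algebraMap K L (compressedAction k K L x b) =
      autAction k L (heckeIdempotent (galoisSubgroup k K L) * x) (algebraMap K L b) := by
  rw [map_mul]
  exact algebraMap_normalizedTrace _

/-- Composing two compressions inserts the projection `e_G` between `x` and `y`, where `x e_G = x`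
absorbs it. -/
lemma compressedAction_mul {x : MonoidAlgebra ℚ (L ≃ₐ[k] L)} (y : MonoidAlgebra ℚ (L ≃ₐ[k] L))
    (hx : x * heckeIdempotent (galoisSubgroup k K L) = x) :
    compressedAction k K L (x * y) = compressedAction k K L x * compressedAction k K L y := by
  refine LinearMap.ext fun b ↦ (algebraMap K L).injective ?_
  rw [Module.End.mul_apply, algebraMap_compressedAction, algebraMap_compressedAction,
    algebraMap_compressedAction, ← Module.End.mul_apply, ← map_mul, mul_assoc _ x,
    ← mul_assoc x, hx]

lemma compressedAction_heckeIdempotent :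
    compressedAction k K L (heckeIdempotent (galoisSubgroup k K L)) = 1 := by
  refine LinearMap.ext fun b ↦ (algebraMap K L).injective ?_
  rw [algebraMap_compressedAction, (heckeIdempotent_isIdempotentElem _).eq,
    ← algebraMap_normalizedTrace, normalizedTrace, LinearMap.smul_apply]
  change algebraMap K L ((1 / Module.finrank K L : ℚ) • Algebra.trace K L (algebraMap K L b)) = _
  rw [Algebra.trace_algebraMap, ← Nat.cast_smul_eq_nsmul ℚ, smul_smul, one_div,
    inv_mul_cancel₀ (Nat.cast_ne_zero.2 Module.finrank_pos.ne'), one_smul]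
  rfl

/-- Since `x = e_G x e_G`, the action of `x` on `L` factors through the projection to `K` and lands
in `K`. If its compression vanishes then so does the whole action, which is faithful. -/
lemma eq_zero_of_compressedAction_eq_zero {x : MonoidAlgebra ℚ (L ≃ₐ[k] L)}
    (hl : heckeIdempotent (galoisSubgroup k K L) * x = x)
    (hr : x * heckeIdempotent (galoisSubgroup k K L) = x)
    (h : compressedAction k K L x = 0) : x = 0 := by
  refine autAction_injective (LinearMap.ext fun b ↦ ?_)
  rw [← hr, map_mul, Module.End.mul_apply, ← algebraMap_normalizedTrace, map_zero]
  have := algebraMap_compressedAction x (normalizedTrace K L b)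
  rw [h, hl, LinearMap.zero_apply, map_zero] at this
  exact this.symm

end Galois

/-! ### Classes of twists as a map from the Hecke algebra. -/

section TraceRepresentation

variable {k : Type*} {K L : Type u} [Field k] [Field K] [Field L] [Algebra k K]
  [Algebra k L] [Algebra K L] [IsScalarTower k K L] [FiniteDimensional K L] [IsGalois K L]

lemma leftTrace_unit : (BalancedBimodule.unit : BalancedBimodule k K L).toBimodule.leftTrace =
    AddMonoidHom.id K := by
  ext b
  have h := leftTrace_restrict_ofHom (k := k) (K := K) (L := K) (AlgHom.id k K) (AlgHom.id k K) b
  rw [Algebra.trace_self_apply] at h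
  exact h

variable (k K L) in
/-- The linear map from the rational group algebra of `Aut L` that sends `φ` to the class of the
`K`-bimodule underlying `L_φ`. -/
def twistClass : MonoidAlgebra ℚ (L ≃ₐ[k] L) →ₗ[ℚ] ℚ ⊗[ℤ] GrothendieckRing k K L :=
  Finsupp.linearCombination ℚ
    (fun φ : L ≃ₐ[k] L ↦ (1 : ℚ) ⊗ₜ[ℤ] (BalancedBimodule.twist (K := K) φ).cls) ∘ₗ
      (MonoidAlgebra.coeffLinearEquiv ℚ).toLinearMap

lemma twistClass_single (φ : L ≃ₐ[k] L) : twistClass k K L (MonoidAlgebra.single φ 1) =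
    1 ⊗ₜ (BalancedBimodule.twist (K := K) φ).cls :=
  (Finsupp.linearCombination_single ℚ (1 : ℚ) φ).trans (one_smul _ _)

lemma twistClass_galois_mul (x : MonoidAlgebra ℚ (L ≃ₐ[k] L)) (g h : L ≃ₐ[K] L) :
    twistClass k K L (MonoidAlgebra.single (g.restrictScalars k) 1 * x *
      MonoidAlgebra.single (h.restrictScalars k) 1) = twistClass k K L x := by
  have : twistClass k K L ∘ₗ
      LinearMap.mulRight ℚ (MonoidAlgebra.single (h.restrictScalars k) 1) ∘ₗ
      LinearMap.mulLeft ℚ (MonoidAlgebra.single (g.restrictScalars k) 1) = twistClass k K L := by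
    refine MonoidAlgebra.lhom_ext' fun φ ↦ LinearMap.ext_ring ?_
    rw [LinearMap.comp_apply, LinearMap.comp_apply, LinearMap.comp_apply, LinearMap.comp_apply,
      MonoidAlgebra.lsingle_apply, LinearMap.mulLeft_apply, LinearMap.mulRight_apply,
      MonoidAlgebra.single_mul_single, MonoidAlgebra.single_mul_single, one_mul, one_mul,
      twistClass_single, twistClass_single, cls_twist_galois]
  exact LinearMap.congr_fun this x

/-- An average over `G × G` of values that are all equal. -/
lemma twistClass_heckeIdempotent_mul (x : MonoidAlgebra ℚ (L ≃ₐ[k] L)) :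
    twistClass k K L (heckeIdempotent (galoisSubgroup k K L) * x *
      heckeIdempotent (galoisSubgroup k K L)) = twistClass k K L x := by
  have h0 : (Module.finrank K L : ℚ) ≠ 0 := Nat.cast_ne_zero.2 Module.finrank_pos.ne'
  rw [heckeIdempotent_galoisSubgroup, smul_mul_assoc, smul_mul_assoc, mul_smul_comm,
    Finset.sum_mul, Finset.sum_mul_sum, map_smul, map_smul, map_sum]
  simp only [map_sum, twistClass_galois_mul, Finset.sum_const, Finset.card_univ,
    ← Nat.card_eq_fintype_card, IsGalois.card_aut_eq_finrank]
  rw [← Nat.cast_smul_eq_nsmul ℚ, ← Nat.cast_smul_eq_nsmul ℚ, smul_smul, smul_smul, smul_smul,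
    one_div, ← mul_inv, mul_assoc, inv_mul_cancel₀ (mul_ne_zero h0 h0),
    one_smul]

/-- A positive multiple of each `[V]` is a sum of classes of twists, and the multiplier is
invertible in `ℚ`. -/
lemma twistClass_surjective : Function.Surjective (twistClass k K L) := by
  have h0 : ((Module.finrank K L ^ 2 : ℕ) : ℚ) ≠ 0 :=
    Nat.cast_ne_zero.2 (pow_ne_zero _ Module.finrank_pos.ne')
  have h1 : ∀ x : GrothendieckRing k K L,
      (1 : ℚ) ⊗ₜ[ℤ] x ∈ LinearMap.range (twistClass k K L) := by
    intro x
    refine cls_induction (p := fun x ↦ (1 : ℚ) ⊗ₜ[ℤ] x ∈ LinearMap.range (twistClass k K L)) x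
      ?_ (fun V ↦ ?_) (fun x hx ↦ ?_) fun x y hx hy ↦ ?_
    · rw [TensorProduct.tmul_zero]
      exact zero_mem _
    · obtain ⟨n, φ, h⟩ := exists_finrank_sq_mul_cls V
      have h2 : ((Module.finrank K L ^ 2 : ℕ) : ℚ) • ((1 : ℚ) ⊗ₜ[ℤ] V.cls) =
          twistClass k K L (∑ i, MonoidAlgebra.single (φ i) 1) := by
        rw [map_sum]
        simp only [twistClass_single]
        rw [← TensorProduct.tmul_sum, ← h, Nat.cast_smul_eq_nsmul, TensorProduct.tmul_smul]
      rw [← inv_smul_smul₀ h0 ((1 : ℚ) ⊗ₜ[ℤ] V.cls), h2]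
      exact Submodule.smul_mem _ _ ⟨_, rfl⟩
    · rw [TensorProduct.tmul_neg]
      exact neg_mem hx
    · rw [TensorProduct.tmul_add]
      exact add_mem hx hy
  refine LinearMap.range_eq_top.1 (Submodule.eq_top_iff'.2 fun x ↦ ?_)
  induction x with
  | zero => exact zero_mem _
  | add x y hx hy => exact add_mem hx hy
  | tmul c x =>
    have : c ⊗ₜ[ℤ] x = c • ((1 : ℚ) ⊗ₜ[ℤ] x) := by
      rw [TensorProduct.smul_tmul', smul_eq_mul, mul_one]
    rw [this]
    exact Submodule.smul_mem _ _ (h1 x)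

variable (k K L) in
/-- The linear map from the Hecke algebra to the rational Grothendieck ring given by
`(1 / [L : K]) • twistClass`. -/
def heckeToGrothendieck :
    HeckeAlgebra (galoisSubgroup k K L) →ₗ[ℚ] ℚ ⊗[ℤ] GrothendieckRing k K L :=
  -- The factor makes `e_G` go to `1`, because the class of `L` itself is `[L : K]`.
  (1 / Module.finrank K L : ℚ) • twistClass k K L ∘ₗ
    { toFun := fun x ↦ x.1, map_add' := fun _ _ ↦ rfl, map_smul' := fun _ _ ↦ rfl }

lemma heckeToGrothendieck_apply (x : HeckeAlgebra (galoisSubgroup k K L)) :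
    heckeToGrothendieck k K L x = (1 / Module.finrank K L : ℚ) • twistClass k K L x.1 := rfl

/-- The element `e x e` of the Hecke algebra. -/
def heckeCompress {Ω : Type*} [Group Ω] (G : Subgroup Ω) [Finite G] (x : MonoidAlgebra ℚ Ω) :
    HeckeAlgebra G :=
  ⟨heckeIdempotent G * x * heckeIdempotent G, x, rfl⟩

lemma heckeToGrothendieck_compress (x : MonoidAlgebra ℚ (L ≃ₐ[k] L)) :
    heckeToGrothendieck k K L (heckeCompress (galoisSubgroup k K L) x) =
      (1 / Module.finrank K L : ℚ) • twistClass k K L x :=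
  congrArg ((1 / Module.finrank K L : ℚ) • ·) (twistClass_heckeIdempotent_mul x)

lemma heckeToGrothendieck_surjective : Function.Surjective (heckeToGrothendieck k K L) := by
  have h0 : (Module.finrank K L : ℚ) ≠ 0 := Nat.cast_ne_zero.2 Module.finrank_pos.ne'
  intro y
  obtain ⟨x, rfl⟩ := twistClass_surjective y
  refine ⟨(Module.finrank K L : ℚ) • heckeCompress _ x, ?_⟩
  rw [map_smul, heckeToGrothendieck_compress, smul_smul, one_div, mul_inv_cancel₀ h0, one_smul]

/-! ### The trace representation of the Grothendieck ring. -/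

variable [CharZero K]

variable (k K L) in
/-- The additive map `[V] ↦ leftTrace V`. -/
def traceAddHom : GrothendieckRing k K L →+ Module.End ℚ K :=
  clsLift (fun V ↦ V.toBimodule.leftTrace.toRatLinearMap) fun U V W h ↦ by
    rw [leftTrace_of_shortExact h U.leftFinite V.leftFinite W.leftFinite]
    rfl

lemma traceAddHom_cls (V : BalancedBimodule k K L) :
    traceAddHom k K L V.cls = V.toBimodule.leftTrace.toRatLinearMap := by
  rw [traceAddHom, clsLift_cls]

lemma traceAddHom_mul (x y : GrothendieckRing k K L) :
    traceAddHom k K L (x * y) = traceAddHom k K L x * traceAddHom k K L y := by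
  have h (V : BalancedBimodule k K L) : (traceAddHom k K L).comp (AddMonoidHom.mulLeft V.cls) =
      (AddMonoidHom.mulLeft (traceAddHom k K L V.cls)).comp (traceAddHom k K L) :=
    cls_hom_ext fun W ↦ by
      change traceAddHom k K L (V.cls * W.cls) = traceAddHom k K L V.cls * traceAddHom k K L W.cls
      rw [cls_mul, traceAddHom_cls, traceAddHom_cls, traceAddHom_cls]
      change (V.toBimodule.tensor W.toBimodule).leftTrace.toRatLinearMap = _
      rw [leftTrace_tensor V.leftFinite W.leftFinite]
      rfl
  have h' : (traceAddHom k K L).comp (AddMonoidHom.mulRight y) =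
      (AddMonoidHom.mulRight (traceAddHom k K L y)).comp (traceAddHom k K L) :=
    cls_hom_ext fun V ↦ DFunLike.congr_fun (h V) y
  exact DFunLike.congr_fun h' x

variable (k K L) in
/-- The representation of `K₀(K, L)` on `K` in which `[V]` maps `b` to the trace of the right
multiplication by `b` on the left vector space `V`. -/
def traceRingHom : GrothendieckRing k K L →+* Module.End ℚ K :=
  { traceAddHom k K L with
    map_one' := (traceAddHom_cls _).trans (by rw [leftTrace_unit]; rfl)
    map_mul' := traceAddHom_mul }

lemma traceRingHom_cls (V : BalancedBimodule k K L) (b : K) :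
    traceRingHom k K L V.cls b = V.toBimodule.leftTrace b :=
  DFunLike.congr_fun (traceAddHom_cls V) b

variable (k K L) in
/-- The rational extension of `traceRingHom`. -/
def traceAlgHom : ℚ ⊗[ℤ] GrothendieckRing k K L →ₐ[ℚ] Module.End ℚ K :=
  Algebra.TensorProduct.lift (Algebra.ofId ℚ _) (traceRingHom k K L).toIntAlgHom
    fun c _ ↦ Algebra.commute_algebraMap_left c _

lemma traceAlgHom_one_tmul (x : GrothendieckRing k K L) :
    traceAlgHom k K L (1 ⊗ₜ x) = traceRingHom k K L x := by
  refine (Algebra.TensorProduct.lift_tmul _ _ _ _ _).trans ?_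
  rw [map_one, one_mul]
  rfl

lemma traceRingHom_twist (φ : L ≃ₐ[k] L) (b : K) :
    traceRingHom k K L (BalancedBimodule.twist (K := K) φ).cls b =
      Algebra.trace K L (φ (algebraMap K L b)) :=
  (traceRingHom_cls _ b).trans
    (leftTrace_restrict_ofHom (φ : L →ₐ[k] L) (IsScalarTower.toAlgHom k K L) b)

lemma traceRingHom_simple (φ : L ≃ₐ[k] L) (b : K) :
    traceRingHom k K L (BalancedBimodule.simple (K := K) φ).cls b =
      Algebra.trace K (IntermediateField.fixedField (stabilizer K φ)) (fixedEmbedding K φ b) :=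
  (traceRingHom_cls _ b).trans
    (leftTrace_restrict_ofHom (fixedEmbedding K φ) (AlgHom.id k K) b)

/-- For `b` in `K` the element `φ b` lies in `L^H`, so its trace from `L` to `L^H` is `|H| φ b`;
transitivity of the trace does the rest. -/
lemma traceRingHom_twist_eq_smul (φ : L ≃ₐ[k] L) :
    traceRingHom k K L (BalancedBimodule.twist (K := K) φ).cls =
      Nat.card (stabilizer K φ) •
        traceRingHom k K L (BalancedBimodule.simple (K := K) φ).cls := by
  refine LinearMap.ext fun b ↦ ?_
  rw [LinearMap.smul_apply, traceRingHom_twist, traceRingHom_simple,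
    ← Algebra.trace_trace (S := IntermediateField.fixedField (stabilizer K φ)) (φ _)]
  have h : φ (algebraMap K L b) =
      algebraMap (IntermediateField.fixedField (stabilizer K φ)) L (fixedEmbedding K φ b) := rfl
  rw [h, Algebra.trace_algebraMap, map_nsmul, IntermediateField.finrank_fixedField_eq_card]

/-! ### Faithfulness and the isomorphism. -/

variable [CharZero L]

/-- On an automorphism `φ` both sides are `b ↦ Tr(φ b)`. This identity ties the two representations
on `K` together. -/
lemma traceAlgHom_twistClass (x : MonoidAlgebra ℚ (L ≃ₐ[k] L)) :
    traceAlgHom k K L (twistClass k K L x) =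
      (Module.finrank K L : ℚ) • compressedAction k K L x := by
  have h0 : (Module.finrank K L : ℚ) ≠ 0 := Nat.cast_ne_zero.2 Module.finrank_pos.ne'
  have : (traceAlgHom k K L).toLinearMap ∘ₗ twistClass k K L =
      (Module.finrank K L : ℚ) • compressedAction k K L := by
    refine MonoidAlgebra.lhom_ext' fun φ ↦ LinearMap.ext_ring (LinearMap.ext fun b ↦ ?_)
    change traceAlgHom k K L (twistClass k K L (MonoidAlgebra.single φ 1)) b =
      (Module.finrank K L : ℚ) • normalizedTrace K L
        (autAction k L (MonoidAlgebra.single φ 1) (algebraMap K L b))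
    rw [twistClass_single, traceAlgHom_one_tmul, traceRingHom_twist, autAction_single, one_smul,
      normalizedTrace, LinearMap.smul_apply, smul_smul, one_div, mul_inv_cancel₀ h0, one_smul]
    rfl
  exact LinearMap.congr_fun this x

lemma traceAlgHom_heckeToGrothendieck (x : HeckeAlgebra (galoisSubgroup k K L)) :
    traceAlgHom k K L (heckeToGrothendieck k K L x) = compressedAction k K L x.1 := by
  have h0 : (Module.finrank K L : ℚ) ≠ 0 := Nat.cast_ne_zero.2 Module.finrank_pos.ne'
  rw [heckeToGrothendieck_apply, map_smul, traceAlgHom_twistClass, smul_smul, one_div,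
    inv_mul_cancel₀ h0, one_smul]

lemma compressedAction_injective_on_hecke {x : HeckeAlgebra (galoisSubgroup k K L)}
    (h : compressedAction k K L x.1 = 0) : x = 0 := by
  obtain ⟨hl, hr⟩ := (Subsemigroup.mem_corner_iff (heckeIdempotent_isIdempotentElem _)).1 x.2
  exact Subtype.ext (eq_zero_of_compressedAction_eq_zero hl hr h)

lemma heckeToGrothendieck_injective : Function.Injective (heckeToGrothendieck k K L) :=
  (injective_iff_map_eq_zero _).2 fun x hx ↦ compressedAction_injective_on_hecke (by
    rw [← traceAlgHom_heckeToGrothendieck, hx, map_zero])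

/-- Every rational class comes from the Hecke algebra, where the trace representation becomes the
faithful compressed action. Thus identities of rational classes may be checked on traces. -/
lemma traceAlgHom_injective : Function.Injective (traceAlgHom k K L) := by
  refine (injective_iff_map_eq_zero _).2 fun y hy ↦ ?_
  obtain ⟨x, rfl⟩ := heckeToGrothendieck_surjective y
  rw [traceAlgHom_heckeToGrothendieck] at hy
  rw [compressedAction_injective_on_hecke hy, map_zero]

variable (k K L) in
/-- The isomorphism of the Hecke algebra with the rational Grothendieck ring. -/
def heckeEquivGrothendieck :
    HeckeAlgebra (galoisSubgroup k K L) ≃ₐ[ℚ] ℚ ⊗[ℤ] GrothendieckRing k K L :=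
  AlgEquiv.ofLinearEquiv
    (LinearEquiv.ofBijective (heckeToGrothendieck k K L)
      ⟨heckeToGrothendieck_injective, heckeToGrothendieck_surjective⟩)
    -- The unit and the products are compared in `End_ℚ(K)`, where both algebras act compatibly; no
    -- tensor product of twists has to be decomposed.
    (traceAlgHom_injective (by
      change traceAlgHom k K L (heckeToGrothendieck k K L 1) = _
      rw [traceAlgHom_heckeToGrothendieck, map_one]
      exact compressedAction_heckeIdempotent))
    (fun x y ↦ traceAlgHom_injective (by
      change traceAlgHom k K L (heckeToGrothendieck k K L (x * y)) =
        traceAlgHom k K L (heckeToGrothendieck k K L x * heckeToGrothendieck k K L y)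
      rw [map_mul (traceAlgHom k K L), traceAlgHom_heckeToGrothendieck, traceAlgHom_heckeToGrothendieck,
        traceAlgHom_heckeToGrothendieck]
      exact compressedAction_mul _
        ((Subsemigroup.mem_corner_iff (heckeIdempotent_isIdempotentElem _)).1 x.2).2))

/-- Faithfulness of the trace representation replaces an explicit decomposition of `L_φ` into copies
of `V(φ)`. -/
lemma twist_eq_smul_simple (φ : L ≃ₐ[k] L) :
    (1 : ℚ) ⊗ₜ[ℤ] (BalancedBimodule.twist (K := K) φ).cls =
      (Nat.card (stabilizer K φ) : ℚ) • (1 : ℚ) ⊗ₜ[ℤ] (BalancedBimodule.simple (K := K) φ).cls :=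
  traceAlgHom_injective (by
    rw [map_smul, traceAlgHom_one_tmul, traceAlgHom_one_tmul, traceRingHom_twist_eq_smul,
      Nat.cast_smul_eq_nsmul])

lemma simple_eq_smul_twist (φ : L ≃ₐ[k] L) :
    (1 : ℚ) ⊗ₜ[ℤ] (BalancedBimodule.simple (K := K) φ).cls =
      (1 / Nat.card (stabilizer K φ) : ℚ) • twistClass k K L (MonoidAlgebra.single φ 1) := by
  rw [twistClass_single, twist_eq_smul_simple, smul_smul, one_div,
    inv_mul_cancel₀ (Nat.cast_ne_zero.2 Nat.card_pos.ne'), one_smul]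

lemma heckeEquivGrothendieck_symm_simple (φ : L ≃ₐ[k] L) :
    ((heckeEquivGrothendieck k K L).symm
      (1 ⊗ₜ (BalancedBimodule.simple (K := K) φ).cls)).1 =
        (1 / Nat.card (galoisSubgroup k K L) : ℚ) • doubleCosetSum (galoisSubgroup k K L) φ := by
  have h0 : (Module.finrank K L : ℚ) ≠ 0 := Nat.cast_ne_zero.2 Module.finrank_pos.ne'
  have h1 : (Nat.card (stabilizer K φ) : ℚ) ≠ 0 := Nat.cast_ne_zero.2 Nat.card_pos.ne'
  -- As `[V(φ)] = (1/|H|)[L_φ]` and `e φ e` maps to `(1/n)[L_φ]` with `n = [L : K]`, the coefficient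
  -- is `n/|H|`. The factor `|H|/n²` from the double coset count then leaves `1/n = 1/|G|`.
  have h : (heckeEquivGrothendieck k K L).symm
      (1 ⊗ₜ (BalancedBimodule.simple (K := K) φ).cls) =
      ((Module.finrank K L : ℚ) / Nat.card (stabilizer K φ)) •
        heckeCompress (galoisSubgroup k K L) (MonoidAlgebra.single φ 1) := by
    rw [AlgEquiv.symm_apply_eq, map_smul, simple_eq_smul_twist]
    change _ = _ • heckeToGrothendieck k K L _
    rw [heckeToGrothendieck_compress, smul_smul]
    congr 1
    field_simp
  rw [h]
  change _ • (heckeIdempotent (galoisSubgroup k K L) * MonoidAlgebra.single φ 1 *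
    heckeIdempotent (galoisSubgroup k K L)) = _
  rw [heckeIdempotent_mul_single_mul, smul_smul, card_galoisSubgroup]
  congr 1
  field_simp

end TraceRepresentation

end

theorem mainTheorem4 {k : Type v} {K L : Type u} [Field k] [IsAlgClosed k] [CharZero k]
    [Field K] [Field L] [Algebra k K] [Algebra k L] [Algebra K L] [IsScalarTower k K L]
    [FiniteDimensional K L] [IsGalois K L] :
    ∃! Ψ : (ℚ ⊗[ℤ] GrothendieckRing k K L) ≃ₐ[ℚ] HeckeAlgebra (galoisSubgroup k K L),
      ∀ φ : L ≃ₐ[k] L,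
        (Ψ (1 ⊗ₜ (BalancedBimodule.simple φ).cls)).1 =
          (1 / Nat.card (galoisSubgroup k K L) : ℚ) • doubleCosetSum (galoisSubgroup k K L) φ := by
  have : CharZero K := charZero_of_injective_algebraMap (algebraMap k K).injective
  have : CharZero L := charZero_of_injective_algebraMap (algebraMap k L).injective
  refine ⟨(heckeEquivGrothendieck k K L).symm, heckeEquivGrothendieck_symm_simple, fun Ψ hΨ ↦ ?_⟩
  -- The condition fixes `Ψ` on the classes `[V(φ)]`, hence on their multiples, the classes of
  -- twists, which span the rational Grothendieck ring.
  have h : Ψ.toLinearMap ∘ₗ twistClass k K L =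
      (heckeEquivGrothendieck k K L).symm.toLinearMap ∘ₗ twistClass k K L := by
    refine MonoidAlgebra.lhom_ext' fun φ ↦ LinearMap.ext_ring ?_
    change Ψ (twistClass k K L (MonoidAlgebra.single φ 1)) =
      (heckeEquivGrothendieck k K L).symm (twistClass k K L (MonoidAlgebra.single φ 1))
    rw [twistClass_single, twist_eq_smul_simple, map_smul, map_smul]
    congr 1
    exact Subtype.ext ((hΨ φ).trans (heckeEquivGrothendieck_symm_simple φ).symm)
  refine AlgEquiv.ext fun y ↦ ?_
  obtain ⟨x, rfl⟩ := twistClass_surjective y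
  exact LinearMap.congr_fun h x
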